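/- Let $(M,g_M)$ be a Riemannian manifold and $(N,g_N,P)$ a Kähler manifold (finite-dimensional, smooth, without boundary), with Levi-Civita connections $\nabla^M,\nabla^N$; thus $P^2=-I$, $g_N(P\cdot,P\cdot)=g_N$, $\nabla^N P=0$. Let $F:M\to N$ be a semi-invariant Riemannian map: $F$ is smooth, $g_N(F_*Y,F_*Z)=g_M(Y,Z)$ for $Y,Z\in(\ker F_*)^\perp$, and $\mathrm{range}\,F_*=D_1\oplus D_2$ is an orthogonal direct sum of smooth subbundles of $F^{-1}TN$ with $P D_1=D_1$ and $P D_2\subseteq(\mathrm{range}\,F_*)^\perp$. Near $F(q)$, for every $q\in M$, regard $\mathrm{range}\,F_*$ as a smooth distribution on $N$ (that is, fix a smooth distribution near $F(q)$ whose value at $F(p)$ is $F_*(T_pM)$ for all $p$ near $q$), and assume that its orthogonal complement $(\mathrm{range}\,F_*)^\perp$ is totally geodesic: $\nabla^N_UV\in\Gamma((\mathrm{range}\,F_*)^\perp)$ for all $U,V\in\Gamma((\mathrm{range}\,F_*)^\perp)$. Notation. For a section $W$ of $\mathrm{range}\,F_*$ and a section $V$ of $(\mathrm{range}\,F_*)^\perp$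 write $PW=\phi W+\omega W$ and $PV=BV+CV$, where $\phi W,BV$ are the components in $\mathrm{range}\,F_*$ and $\omega W,CV$ those in $(\mathrm{range}\,F_*)^\perp$. Let ${}^*F_*$ be the adjoint of $F_*$, let $(\nabla F_*)(X,Y)=\nabla^{F}_X(F_*Y)-F_*(\nabla^M_XY)$, with $\nabla^F$ the connection on $F^{-1}TN$ induced by $\nabla^N$, and for a section $Z$ of $(\mathrm{range}\,F_*)^\perp$ let $\nabla^N_{F_*X}Z=-S_ZF_*X+\nabla^{F\perp}_XZ$ be the decomposition into components in $\mathrm{range}\,F_*$ and $(\mathrm{range}\,F_*)^\perp$. For a vector $U\in(\mathrm{range}\,F_*)^\perp$, $\nabla^{F\perp}_UZ$ is the component of $\nabla^N_UZ$ in $(\mathrm{range}\,F_*)^\perp$. Let $I\subseteq\mathbb R$ be an open interval, $\alpha:I\to M$ a geodesic and $\beta=F\circ\alpha$. For every $t\in I$ with $\dot\beta(t)\ne0$ let $F_*X$ and $V$ be the components of $\dot\beta$ near $t$, in the following sense: $X$ is a smooth section of $(\ker F_*)^\perp$ near $\alpha(t)$ and $W$ a smooth section of $\mathrm{range}\,F_*$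 on $N$ near $\beta(t)$ with $F_*X=W\circ F$, $V$ is a smooth section of $(\mathrm{range}\,F_*)^\perp$ on $N$ near $\beta(t)$, and $\dot\beta(s)=W(\beta(s))+V(\beta(s))$ for $s$ near $t$; below, $F_*X$ also denotes $W$. (Such fields exist for every such $t$, and any choice is allowed. Where $\dot\beta(t)=0$ both components vanish.) Then $\beta$ is a geodesic of $N$ if and only if, at every $t\in I$ with $\dot\beta(t)\neq 0$, $$-S_{\omega F_*X}F_*X+F_*(\nabla^M_X{}^*F_*BV)-S_{CV}F_*X+\nabla^N_V\phi F_*X+\nabla^N_VBV+F_*(\nabla^M_X{}^*F_*\phi F_*X)=0$$ and $$(\nabla F_*)(X,{}^*F_*\phi F_*X)+\nabla^{F\perp}_X\omega F_*X+(\nabla F_*)(X,{}^*F_*BV)+\nabla^{F\perp}_XCV+\nabla^{F\perp}_V\omega F_*X+\nabla^{F\perp}_VCV=0 .$$ -/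

import Mathlib

open Filter Topology Bundle
open scoped Manifold ContDiff

noncomputable section

namespace RiemMap

/-! ### Smooth fields, Levi-Civita connections, geodesics -/

section Connection

variable {E : Type*} [NormedAddCommGroup E] [NormedSpace ℝ E] [FiniteDimensional ℝ E]
  {N : Type*} [TopologicalSpace N] [ChartedSpace E N] [IsManifold 𝓘(ℝ, E) ∞ N]

instance finiteDimensionalTangentSpace (y : N) :
    FiniteDimensional ℝ (TangentSpace 𝓘(ℝ, E) y) :=
  inferInstanceAs (FiniteDimensional ℝ E)

/-- The vector field `Y` on `N` is smooth on a neighbourhood of `y`. -/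
def SmoothFieldNear (Y : Π y : N, TangentSpace 𝓘(ℝ, E) y) (y : N) : Prop :=
  ∀ᶠ z in 𝓝 y, ContMDiffAt 𝓘(ℝ, E) 𝓘(ℝ, E).tangent ∞
    (fun p : N => (⟨p, Y p⟩ : TangentBundle 𝓘(ℝ, E) N)) z

/-- Near `y`, the family `D` of subspaces of the tangent spaces of `N` is a smooth distribution:
it is spanned by a smooth local frame. -/
def SmoothDistributionNear (D : Π y : N, Submodule ℝ (TangentSpace 𝓘(ℝ, E) y)) (y : N) : Prop :=
  ∃ (k : ℕ) (s : Fin k → Π y : N, TangentSpace 𝓘(ℝ, E) y),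
    (∀ i, SmoothFieldNear (s i) y) ∧
    ∀ᶠ z in 𝓝 y, LinearIndependent ℝ (fun i => s i z) ∧
      Submodule.span ℝ (Set.range fun i => s i z) = D z

/-- `∇` is the Levi-Civita connection of the Riemannian manifold `N`: the (unique) covariant
derivative on `TN` that is torsion-free and compatible with the metric.
In Mathlib's argument order `∇ Y y v` is the covariant derivative `(∇_v Y)(y)`. -/
structure IsLeviCivita [RiemannianBundle (fun y : N => TangentSpace 𝓘(ℝ, E) y)]
    [IsContMDiffRiemannianBundle 𝓘(ℝ, E) ∞ E (fun y : N => TangentSpace 𝓘(ℝ, E) y)]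
    (cov : CovariantDerivative 𝓘(ℝ, E) E (TangentSpace 𝓘(ℝ, E) : N → Type _)) : Prop where
  torsion_free : cov.torsion = 0
  metric : ∀ (y : N) (Y Z : Π y : N, TangentSpace 𝓘(ℝ, E) y),
    MDifferentiableAt 𝓘(ℝ, E) 𝓘(ℝ, E).tangent
      (fun p : N => (⟨p, Y p⟩ : TangentBundle 𝓘(ℝ, E) N)) y →
    MDifferentiableAt 𝓘(ℝ, E) 𝓘(ℝ, E).tangent
      (fun p : N => (⟨p, Z p⟩ : TangentBundle 𝓘(ℝ, E) N)) y →
    ∀ v : TangentSpace 𝓘(ℝ, E) y,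
      mfderiv 𝓘(ℝ, E) 𝓘(ℝ, ℝ) (fun p : N => (inner ℝ (Y p) (Z p) : ℝ)) y v
        = (inner ℝ (cov Y y v) (Z y) + inner ℝ (Y y) (cov Z y v) : ℝ)

variable {E' : Type*} [NormedAddCommGroup E'] [NormedSpace ℝ E']
  {M : Type*} [TopologicalSpace M] [ChartedSpace E' M]

/-- The pullback connection `∇^f` on `f⁻¹TN`, for `f : M → N`: the covariant derivative at `x` of
a vector field `σ` along `f`, as a linear map in the direction. Near `x` write
`σ q = ∑ wⁱ(q) eᵢ(f q)` in the local frame `eᵢ` of `TN` given by the preferred trivialization at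
`f x`; then `∇^f_v σ = ∑ dwⁱ(v) eᵢ(f x) + ∇_{df v} (∑ wⁱ(x) eᵢ)`. -/
def pullbackCov (cov : CovariantDerivative 𝓘(ℝ, E) E (TangentSpace 𝓘(ℝ, E) : N → Type _))
    (f : M → N) (σ : Π q : M, TangentSpace 𝓘(ℝ, E) (f q)) (x : M) :
    TangentSpace 𝓘(ℝ, E') x →L[ℝ] TangentSpace 𝓘(ℝ, E) (f x) :=
  let e := trivializationAt E (TangentSpace 𝓘(ℝ, E) : N → Type _) (f x)
  let dw : TangentSpace 𝓘(ℝ, E') x →L[ℝ] E :=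
    mfderiv 𝓘(ℝ, E') 𝓘(ℝ, E) (fun q : M => (e ⟨f q, σ q⟩).2) x
  (e.symmL ℝ (f x)).comp dw +
    (cov (FiberBundle.extend E (σ x)) (f x)).comp (mfderiv 𝓘(ℝ, E') 𝓘(ℝ, E) f x)

/-- The velocity `γ'(t)` of a curve. -/
def velocity (γ : ℝ → N) (t : ℝ) : TangentSpace 𝓘(ℝ, E) (γ t) :=
  mfderiv 𝓘(ℝ, ℝ) 𝓘(ℝ, E) γ t (1 : ℝ)

/-- The acceleration `∇_{γ'} γ'` of a curve at time `t`. -/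
def acceleration (cov : CovariantDerivative 𝓘(ℝ, E) E (TangentSpace 𝓘(ℝ, E) : N → Type _))
    (γ : ℝ → N) (t : ℝ) : TangentSpace 𝓘(ℝ, E) (γ t) :=
  pullbackCov cov γ (fun s => velocity γ s) t (1 : ℝ)

/-- `γ` restricted to the open interval `I` is a geodesic. -/
def IsGeodesicOn (cov : CovariantDerivative 𝓘(ℝ, E) E (TangentSpace 𝓘(ℝ, E) : N → Type _))
    (γ : ℝ → N) (I : Set ℝ) : Prop :=
  ContMDiffOn 𝓘(ℝ, ℝ) 𝓘(ℝ, E) ∞ γ I ∧ ∀ t ∈ I, acceleration cov γ t = 0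

end Connection

/-! ### Kähler structures, Riemannian maps -/

section Maps

variable {EM : Type*} [NormedAddCommGroup EM] [NormedSpace ℝ EM] [FiniteDimensional ℝ EM]
  {M : Type*} [TopologicalSpace M] [ChartedSpace EM M] [IsManifold 𝓘(ℝ, EM) ∞ M]
  [RiemannianBundle (fun q : M => TangentSpace 𝓘(ℝ, EM) q)]
  [IsContMDiffRiemannianBundle 𝓘(ℝ, EM) ∞ EM (fun q : M => TangentSpace 𝓘(ℝ, EM) q)]
  {EN : Type*} [NormedAddCommGroup EN] [NormedSpace ℝ EN] [FiniteDimensional ℝ EN]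
  {N : Type*} [TopologicalSpace N] [ChartedSpace EN N] [IsManifold 𝓘(ℝ, EN) ∞ N]
  [RiemannianBundle (fun y : N => TangentSpace 𝓘(ℝ, EN) y)]
  [IsContMDiffRiemannianBundle 𝓘(ℝ, EN) ∞ EN (fun y : N => TangentSpace 𝓘(ℝ, EN) y)]

/-- `P` is a smooth almost complex structure on `N`, orthogonal for the metric and parallel for
the Levi-Civita connection `cov`; that is, `(N, g, P)` is a Kähler manifold. -/
structure IsKahler
    (cov : CovariantDerivative 𝓘(ℝ, EN) EN (TangentSpace 𝓘(ℝ, EN) : N → Type _))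
    (P : Π y : N, TangentSpace 𝓘(ℝ, EN) y →L[ℝ] TangentSpace 𝓘(ℝ, EN) y) : Prop where
  smooth : ContMDiff 𝓘(ℝ, EN) (𝓘(ℝ, EN).prod 𝓘(ℝ, EN →L[ℝ] EN)) ∞
    (fun y : N => (⟨y, P y⟩ : TotalSpace (EN →L[ℝ] EN)
      (fun y : N => TangentSpace 𝓘(ℝ, EN) y →L[ℝ] TangentSpace 𝓘(ℝ, EN) y)))
  sq : ∀ (y : N) (u : TangentSpace 𝓘(ℝ, EN) y), P y (P y u) = -u
  orthogonal : ∀ (y : N) (u v : TangentSpace 𝓘(ℝ, EN) y),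
    inner ℝ (P y u) (P y v) = inner ℝ u v
  parallel : ∀ (y : N) (Y : Π y : N, TangentSpace 𝓘(ℝ, EN) y),
    MDifferentiableAt 𝓘(ℝ, EN) 𝓘(ℝ, EN).tangent
      (fun p : N => (⟨p, Y p⟩ : TangentBundle 𝓘(ℝ, EN) N)) y →
    ∀ v : TangentSpace 𝓘(ℝ, EN) y, cov (fun p => P p (Y p)) y v = P y (cov Y y v)

/-- The differential `F_*` at `q`. -/
abbrev dF (F : M → N) (q : M) :
    TangentSpace 𝓘(ℝ, EM) q →L[ℝ] TangentSpace 𝓘(ℝ, EN) (F q) :=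
  mfderiv 𝓘(ℝ, EM) 𝓘(ℝ, EN) F q

/-- `ker F_*` at `q`. -/
def kerF (F : M → N) (q : M) : Submodule ℝ (TangentSpace 𝓘(ℝ, EM) q) :=
  LinearMap.ker (dF F q : TangentSpace 𝓘(ℝ, EM) q →L[ℝ] TangentSpace 𝓘(ℝ, EN) (F q)).toLinearMap

/-- `range F_*` at `q`, a subspace of the tangent space of `N` at `F q`. -/
def rangeF (F : M → N) (q : M) : Submodule ℝ (TangentSpace 𝓘(ℝ, EN) (F q)) :=
  LinearMap.range (dF F q : TangentSpace 𝓘(ℝ, EM) q →L[ℝ] TangentSpace 𝓘(ℝ, EN) (F q)).toLinearMap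

/-- The adjoint `*F_*` of the differential at `q`, for the two Riemannian metrics. -/
def adjF (F : M → N) (q : M) :
    TangentSpace 𝓘(ℝ, EN) (F q) →ₗ[ℝ] TangentSpace 𝓘(ℝ, EM) q :=
  LinearMap.adjoint
    ((dF F q : TangentSpace 𝓘(ℝ, EM) q →L[ℝ] TangentSpace 𝓘(ℝ, EN) (F q)).toLinearMap)

/-- `F` is a Riemannian map: it is smooth and `F_*` is isometric on `(ker F_*)^⊥`. -/
structure IsRiemannianMap (F : M → N) : Prop where
  smooth : ContMDiff 𝓘(ℝ, EM) 𝓘(ℝ, EN) ∞ F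
  isometric : ∀ (q : M), ∀ u ∈ (kerF (EM := EM) (EN := EN) F q)ᗮ, ∀ v ∈ (kerF (EM := EM) (EN := EN) F q)ᗮ,
    (inner ℝ (dF (EM := EM) (EN := EN) F q u) (dF (EM := EM) (EN := EN) F q v) : ℝ) = inner ℝ u v

/-- The family `D` of subspaces of the fibres of `F⁻¹TN` is a smooth subbundle: locally it is
spanned by a smooth frame of vector fields along `F`. -/
def IsSubbundleAlong (F : M → N) (D : Π q : M, Submodule ℝ (TangentSpace 𝓘(ℝ, EN) (F q))) :
    Prop :=
  ∀ q : M, ∃ (k : ℕ) (s : Fin k → Π q : M, TangentSpace 𝓘(ℝ, EN) (F q)),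
    (∀ i, ∀ᶠ p in 𝓝 q, ContMDiffAt 𝓘(ℝ, EM) 𝓘(ℝ, EN).tangent ∞
      (fun x : M => (⟨F x, s i x⟩ : TangentBundle 𝓘(ℝ, EN) N)) p) ∧
    ∀ᶠ p in 𝓝 q, LinearIndependent ℝ (fun i => s i p) ∧
      Submodule.span ℝ (Set.range fun i => s i p) = D p

/-- `F` is a semi-invariant Riemannian map into `(N, g, P)`: `range F_*` is the orthogonal direct
sum of subbundles `D₁`, `D₂` with `P D₁ = D₁` and `P D₂ ⊆ (range F_*)^⊥`. -/
structure IsSemiInvariantRiemannianMap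
    (P : Π y : N, TangentSpace 𝓘(ℝ, EN) y →L[ℝ] TangentSpace 𝓘(ℝ, EN) y) (F : M → N) :
    Prop extends
    IsRiemannianMap (EM := EM) (EN := EN) F where
  exists_subbundles : ∃ D₁ D₂ : Π q : M, Submodule ℝ (TangentSpace 𝓘(ℝ, EN) (F q)),
    IsSubbundleAlong (EM := EM) (EN := EN) F D₁ ∧ IsSubbundleAlong (EM := EM) (EN := EN) F D₂ ∧
    ∀ q : M, D₁ q ⟂ D₂ q ∧ D₁ q ⊔ D₂ q = rangeF (EM := EM) (EN := EN) F q ∧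
      (D₁ q).map (P (F q) : TangentSpace 𝓘(ℝ, EN) (F q) →ₗ[ℝ] TangentSpace 𝓘(ℝ, EN) (F q))
        = D₁ q ∧
      (D₂ q).map (P (F q) : TangentSpace 𝓘(ℝ, EN) (F q) →ₗ[ℝ] TangentSpace 𝓘(ℝ, EN) (F q))
        ≤ (rangeF (EM := EM) (EN := EN) F q)ᗮ

/-! ### The range of `F_*` as a local distribution on the target -/

/-- `D` is a smooth distribution on `N` near `F q` that restricts to `range F_*` along `F`
(near `q`). -/
structure IsRangeDistribution (F : M → N) (q : M)
    (D : Π y : N, Submodule ℝ (TangentSpace 𝓘(ℝ, EN) y)) : Prop where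
  smooth : SmoothDistributionNear D (F q)
  eq_range : ∀ᶠ p in 𝓝 q, D (F p) = rangeF (EM := EM) (EN := EN) F p

/-- The normal distribution `D^⊥` is totally geodesic near `y₀`: `∇_U V` lies in `D^⊥` (it equals
its orthogonal projection to `D^⊥`) for all local sections `U`, `V` of `D^⊥`. -/
def NormalTotallyGeodesicNear
    (cov : CovariantDerivative 𝓘(ℝ, EN) EN (TangentSpace 𝓘(ℝ, EN) : N → Type _))
    (D : Π y : N, Submodule ℝ (TangentSpace 𝓘(ℝ, EN) y)) (y₀ : N) : Prop :=
  ∀ᶠ y in 𝓝 y₀, ∀ U V : Π y : N, TangentSpace 𝓘(ℝ, EN) y,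
    SmoothFieldNear U y → SmoothFieldNear V y →
    (∀ᶠ z in 𝓝 y, U z ∈ (D z)ᗮ ∧ V z ∈ (D z)ᗮ) → cov V y (U y) ∈ (D y)ᗮ

/-- For a field `W` of tangent vectors of `N`: the component of `P W` in `D`. On sections of `D`
this is `φ`, on sections of `D^⊥` it is `B`. -/
def tanPart (P : Π y : N, TangentSpace 𝓘(ℝ, EN) y →L[ℝ] TangentSpace 𝓘(ℝ, EN) y)
    (D : Π y : N, Submodule ℝ (TangentSpace 𝓘(ℝ, EN) y))
    (W : Π y : N, TangentSpace 𝓘(ℝ, EN) y) (y : N) : TangentSpace 𝓘(ℝ, EN) y :=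
  (D y).starProjection (P y (W y))

/-- For a field `W` of tangent vectors of `N`: the component of `P W` in `D^⊥`. On sections of
`D` this is `ω`, on sections of `D^⊥` it is `C`. -/
def norPart (P : Π y : N, TangentSpace 𝓘(ℝ, EN) y →L[ℝ] TangentSpace 𝓘(ℝ, EN) y)
    (D : Π y : N, Submodule ℝ (TangentSpace 𝓘(ℝ, EN) y))
    (W : Π y : N, TangentSpace 𝓘(ℝ, EN) y) (y : N) : TangentSpace 𝓘(ℝ, EN) y :=
  (D y)ᗮ.starProjection (P y (W y))

/-! ### The operators `∇F_*`, `S`, `∇^{F⊥}` -/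

/-- The second fundamental form `(∇F_*)(u, Y) = ∇^F_u (F_* Y) - F_*(∇_u Y)` at `q`, for a tangent
vector `u` at `q` and a vector field `Y` near `q`. -/
def secondFF (covM : CovariantDerivative 𝓘(ℝ, EM) EM (TangentSpace 𝓘(ℝ, EM) : M → Type _))
    (covN : CovariantDerivative 𝓘(ℝ, EN) EN (TangentSpace 𝓘(ℝ, EN) : N → Type _))
    (F : M → N) (q : M) (u : TangentSpace 𝓘(ℝ, EM) q) (Y : Π q : M, TangentSpace 𝓘(ℝ, EM) q) :
    TangentSpace 𝓘(ℝ, EN) (F q) :=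
  pullbackCov covN F (fun p => dF (EM := EM) (EN := EN) F p (Y p)) q u - dF (EM := EM) (EN := EN) F q (covM Y q u)

/-- `S_Z F_* u` at `q`: minus the component in `range F_*` of `∇^N_{F_* u} Z`, for a section `Z`
of `(range F_*)^⊥` along `F`. -/
def shapeOp (covN : CovariantDerivative 𝓘(ℝ, EN) EN (TangentSpace 𝓘(ℝ, EN) : N → Type _))
    (F : M → N) (Z : Π q : M, TangentSpace 𝓘(ℝ, EN) (F q)) (q : M)
    (u : TangentSpace 𝓘(ℝ, EM) q) : TangentSpace 𝓘(ℝ, EN) (F q) :=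
  -(rangeF (EM := EM) (EN := EN) F q).starProjection (pullbackCov covN F Z q u)

/-- `∇^{F⊥}_u Z` at `q`: the component in `(range F_*)^⊥` of `∇^N_{F_* u} Z`, for a section `Z` of
`(range F_*)^⊥` along `F`. -/
def normalCov (covN : CovariantDerivative 𝓘(ℝ, EN) EN (TangentSpace 𝓘(ℝ, EN) : N → Type _))
    (F : M → N) (Z : Π q : M, TangentSpace 𝓘(ℝ, EN) (F q)) (q : M)
    (u : TangentSpace 𝓘(ℝ, EM) q) : TangentSpace 𝓘(ℝ, EN) (F q) :=
  (rangeF (EM := EM) (EN := EN) F q)ᗮ.starProjection (pullbackCov covN F Z q u)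

/-- `∇^{F⊥}_U Z` at `F q`, for a section `Z` of `(range F_*)^⊥` defined on an open set of `N` and
a tangent vector `U` of `N`: the component of `∇^N_U Z` in `(range F_*)^⊥`. -/
def normalCovTarget (covN : CovariantDerivative 𝓘(ℝ, EN) EN (TangentSpace 𝓘(ℝ, EN) : N → Type _))
    (F : M → N) (Z : Π y : N, TangentSpace 𝓘(ℝ, EN) y) (q : M)
    (U : TangentSpace 𝓘(ℝ, EN) (F q)) : TangentSpace 𝓘(ℝ, EN) (F q) :=
  (rangeF (EM := EM) (EN := EN) F q)ᗮ.starProjection (covN Z (F q) U)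

/-! ### The components of the velocity and the two equations -/

/-- The components `F_* X` and `V` of the velocity of `β = F ∘ α` near time `t`, as local
sections of `range F_* = D` and `(range F_*)^⊥ = D^⊥`. Here `W` is `F_* X` as a section of `D` on
`N`, and `X` is the horizontal vector field on `M` with `F_* X = W ∘ F`. -/
structure VelocityComponents (F : M → N) (α : ℝ → M) (t : ℝ)
    (D : Π y : N, Submodule ℝ (TangentSpace 𝓘(ℝ, EN) y)) where
  /-- the horizontal field on `M` -/
  X : Π q : M, TangentSpace 𝓘(ℝ, EM) q
  /-- the section `F_* X` of `range F_*` -/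
  W : Π y : N, TangentSpace 𝓘(ℝ, EN) y
  /-- the section of `(range F_*)^⊥` -/
  V : Π y : N, TangentSpace 𝓘(ℝ, EN) y
  smooth_X : SmoothFieldNear X (α t)
  smooth_W : SmoothFieldNear W (F (α t))
  smooth_V : SmoothFieldNear V (F (α t))
  horizontal : ∀ᶠ q in 𝓝 (α t), X q ∈ (kerF (EM := EM) (EN := EN) F q)ᗮ
  related : ∀ᶠ q in 𝓝 (α t), dF (EM := EM) (EN := EN) F q (X q) = W (F q)
  tangential : ∀ᶠ y in 𝓝 (F (α t)), W y ∈ D y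
  normal : ∀ᶠ y in 𝓝 (F (α t)), V y ∈ (D y)ᗮ
  velocity_eq : ∀ᶠ s in 𝓝 t,
    velocity (fun s => F (α s)) s = W (F (α s)) + V (F (α s))

variable {F : M → N} {α : ℝ → M} {t : ℝ} {D : Π y : N, Submodule ℝ (TangentSpace 𝓘(ℝ, EN) y)}

/-- Left-hand side, at time `t`, of the tangential equation:
`- S_{ω F_*X} F_*X + F_*(∇_X *F_* B V) - S_{C V} F_*X + ∇_V φ F_*X + ∇_V B V
  + F_*(∇_X *F_* φ F_*X)`. -/
def VelocityComponents.tangentialLHS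
    (covM : CovariantDerivative 𝓘(ℝ, EM) EM (TangentSpace 𝓘(ℝ, EM) : M → Type _))
    (covN : CovariantDerivative 𝓘(ℝ, EN) EN (TangentSpace 𝓘(ℝ, EN) : N → Type _))
    (P : Π y : N, TangentSpace 𝓘(ℝ, EN) y →L[ℝ] TangentSpace 𝓘(ℝ, EN) y)
    (c : VelocityComponents (EM := EM) F α t D) : TangentSpace 𝓘(ℝ, EN) (F (α t)) :=
  let q := α t
  let u := c.X q
  let v := c.V (F q)
  let φW := tanPart P D c.W
  let ωW := norPart P D c.W
  let BV := tanPart P D c.V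
  let CV := norPart P D c.V;
  -shapeOp (EM := EM) covN F (fun p => ωW (F p)) q u
    + dF (EM := EM) (EN := EN) F q (covM (fun p => adjF (EM := EM) (EN := EN) F p (BV (F p))) q u)
    - shapeOp (EM := EM) covN F (fun p => CV (F p)) q u
    + covN φW (F q) v
    + covN BV (F q) v
    + dF (EM := EM) (EN := EN) F q (covM (fun p => adjF (EM := EM) (EN := EN) F p (φW (F p))) q u)

/-- Left-hand side, at time `t`, of the normal equation:
`(∇F_*)(X, *F_* φ F_*X) + ∇^{F⊥}_X ω F_*X + (∇F_*)(X, *F_* B V) + ∇^{F⊥}_X C V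
  + ∇^{F⊥}_V ω F_*X + ∇^{F⊥}_V C V`. -/
def VelocityComponents.normalLHS
    (covM : CovariantDerivative 𝓘(ℝ, EM) EM (TangentSpace 𝓘(ℝ, EM) : M → Type _))
    (covN : CovariantDerivative 𝓘(ℝ, EN) EN (TangentSpace 𝓘(ℝ, EN) : N → Type _))
    (P : Π y : N, TangentSpace 𝓘(ℝ, EN) y →L[ℝ] TangentSpace 𝓘(ℝ, EN) y)
    (c : VelocityComponents (EM := EM) F α t D) : TangentSpace 𝓘(ℝ, EN) (F (α t)) :=
  let q := α t
  let u := c.X q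
  let v := c.V (F q)
  let φW := tanPart P D c.W
  let ωW := norPart P D c.W
  let BV := tanPart P D c.V
  let CV := norPart P D c.V
  secondFF covM covN F q u (fun p => adjF (EM := EM) (EN := EN) F p (φW (F p)))
    + normalCov (EM := EM) covN F (fun p => ωW (F p)) q u
    + secondFF covM covN F q u (fun p => adjF (EM := EM) (EN := EN) F p (BV (F p)))
    + normalCov (EM := EM) covN F (fun p => CV (F p)) q u
    + normalCovTarget (EM := EM) covN F ωW q v
    + normalCovTarget (EM := EM) covN F CV q v

end Maps

end RiemMap

end

/-! Write `β''` for the acceleration of `β`. As `P` is parallel and `P² = -1`, `β'' = 0` if and only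
if `∇_{β'} (P β') = P β''` vanishes. Near a time with `β' ≠ 0` the velocity is the restriction of `W
+ V`, and `P (W + V) = φW + ωW + BV + CV`. In the direction `W = F_* X` the Gauss formula splits the
derivatives of `φW` and `BV`, and the Weingarten formula those of `ωW` and `CV`. In the direction
`V` the derivatives of `ωW` and `CV` are normal because the normal distribution is totally geodesic;
those of `φW` and `BV` are tangential by metric duality (`NormalTotallyGeodesicNear.cov_mem`). Hence
the two left-hand sides are the tangential and the normal component of `P β''`, and their sum
vanishes exactly when both do (`VelocityComponents.acceleration_eq_zero_iff`).

The Gauss splitting is orthogonal because `(∇F_*)(X, Y)` is normal for horizontal `X`, `Y`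
(`IsRiemannianMap.secondFF_mem_orthogonal`): the expression `⟨(∇F_*)(X, Y), F_* Z⟩` is symmetric in
`X, Y` and skew in `Y, Z`, hence zero.

The equations say nothing where `β' = 0`. There `IsLeviCivita.isGeodesicOn` applies: the derivative
`2⟨β', β''⟩` of `|β'|²` is zero at every time, so the speed is constant on the interval, and a
single zero of `β'` makes `β` stationary throughout. -/

set_option linter.unusedSectionVars false

noncomputable section

namespace RiemMap

/-! ### Local frames of `TN` and differentiable fields along a map -/

section Frame

variable {E : Type*} [NormedAddCommGroup E] [NormedSpace ℝ E] [FiniteDimensional ℝ E]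
  {N : Type*} [TopologicalSpace N] [ChartedSpace E N] [IsManifold 𝓘(ℝ, E) ∞ N]
  {E' : Type*} [NormedAddCommGroup E'] [NormedSpace ℝ E']
  {M : Type*} [TopologicalSpace M] [ChartedSpace E' M]

/-- The `i`-th field of the local frame of `TN` given by the preferred trivialization at `y₀`. -/
def coordFrame (y₀ : N) (i : Fin (Module.finrank ℝ E)) (y : N) : TangentSpace 𝓘(ℝ, E) y :=
  (trivializationAt E (TangentSpace 𝓘(ℝ, E) : N → Type _) y₀).symmL ℝ y (Module.finBasis ℝ E i)

/-- The `i`-th coordinate in the local frame `coordFrame y₀`. -/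
def coordFrameCoeff (y₀ : N) (i : Fin (Module.finrank ℝ E)) (y : N)
    (v : TangentSpace 𝓘(ℝ, E) y) : ℝ :=
  (Module.finBasis ℝ E).coord i
    (trivializationAt E (TangentSpace 𝓘(ℝ, E) : N → Type _) y₀ ⟨y, v⟩).2

lemma eventually_mem_baseSet (y : N) :
    ∀ᶠ z in 𝓝 y, z ∈ (trivializationAt E (TangentSpace 𝓘(ℝ, E) : N → Type _) y).baseSet :=
  (trivializationAt E (TangentSpace 𝓘(ℝ, E) : N → Type _) y).open_baseSet.mem_nhds
    (FiberBundle.mem_baseSet_trivializationAt' y)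

lemma symmL_eq_sum_coordFrame (y₀ y : N) (w : E) :
    (trivializationAt E (TangentSpace 𝓘(ℝ, E) : N → Type _) y₀).symmL ℝ y w =
      ∑ i, (Module.finBasis ℝ E).coord i w • coordFrame y₀ i y := by
  conv_lhs => rw [← (Module.finBasis ℝ E).sum_repr w]
  simp only [map_sum, map_smul, coordFrame, Module.Basis.coord_apply]

lemma eq_sum_coordFrame {y₀ y : N}
    (hy : y ∈ (trivializationAt E (TangentSpace 𝓘(ℝ, E) : N → Type _) y₀).baseSet)
    (v : TangentSpace 𝓘(ℝ, E) y) :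
    v = ∑ i, coordFrameCoeff y₀ i y v • coordFrame y₀ i y := by
  have h := symmL_eq_sum_coordFrame y₀ y
    (trivializationAt E (TangentSpace 𝓘(ℝ, E) : N → Type _) y₀ ⟨y, v⟩).2
  rw [Trivialization.symmL_apply _ hy, Trivialization.symm_apply_apply_mk _ hy] at h
  exact h

lemma contMDiffAt_coordFrame (y₀ : N) (i : Fin (Module.finrank ℝ E)) {y : N}
    (hy : y ∈ (trivializationAt E (TangentSpace 𝓘(ℝ, E) : N → Type _) y₀).baseSet) :
    ContMDiffAt 𝓘(ℝ, E) 𝓘(ℝ, E).tangent ∞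
      (fun p : N => (⟨p, coordFrame y₀ i p⟩ : TangentBundle 𝓘(ℝ, E) N)) y := by
  refine (contMDiffAt_localFrame_of_mem (I := 𝓘(ℝ, E)) ∞
    (trivializationAt E (TangentSpace 𝓘(ℝ, E) : N → Type _) y₀)
    (Module.finBasis ℝ E) i hy).congr_of_eventuallyEq ?_
  filter_upwards [(trivializationAt E (TangentSpace 𝓘(ℝ, E) : N → Type _) y₀).open_baseSet.mem_nhds
    hy] with z hz
  rw [coordFrame, Trivialization.localFrame_apply_of_mem_baseSet _ _ hz, Trivialization.basisAt]
  simp [Trivialization.symmL_apply _ hz]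

lemma mdifferentiableAt_coordFrame (y₀ : N) (i : Fin (Module.finrank ℝ E)) :
    MDifferentiableAt 𝓘(ℝ, E) 𝓘(ℝ, E).tangent
      (fun p : N => (⟨p, coordFrame y₀ i p⟩ : TangentBundle 𝓘(ℝ, E) N)) y₀ :=
  (contMDiffAt_coordFrame y₀ i (FiberBundle.mem_baseSet_trivializationAt' y₀)).mdifferentiableAt
    (by simp)

/-- Differentiability at `x` of a vector field `σ` along `f`. -/
def DiffAlong (f : M → N) (σ : Π q : M, TangentSpace 𝓘(ℝ, E) (f q)) (x : M) : Prop :=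
  MDifferentiableAt 𝓘(ℝ, E') 𝓘(ℝ, E).tangent
    (fun q : M => (⟨f q, σ q⟩ : TangentBundle 𝓘(ℝ, E) N)) x

lemma diffAlong_coordFrame (y₀ : N) (i : Fin (Module.finrank ℝ E)) :
    DiffAlong (E' := E) (fun p : N => p) (coordFrame y₀ i) y₀ :=
  mdifferentiableAt_coordFrame y₀ i

variable {f : M → N} {σ τ : Π q : M, TangentSpace 𝓘(ℝ, E) (f q)} {x : M}

lemma DiffAlong.base (h : DiffAlong (E' := E') f σ x) :
    MDifferentiableAt 𝓘(ℝ, E') 𝓘(ℝ, E) f x :=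
  ((mdifferentiableAt_totalSpace _ _).1 h).1

lemma DiffAlong.coord (h : DiffAlong (E' := E') f σ x) :
    MDifferentiableAt 𝓘(ℝ, E') 𝓘(ℝ, E)
      (fun q => (trivializationAt E (TangentSpace 𝓘(ℝ, E) : N → Type _) (f x) ⟨f q, σ q⟩).2) x :=
  ((mdifferentiableAt_totalSpace _ _).1 h).2

lemma DiffAlong.congr (h : DiffAlong (E' := E') f σ x) (hστ : ∀ᶠ q in 𝓝 x, τ q = σ q) :
    DiffAlong (E' := E') f τ x := by
  refine MDifferentiableAt.congr_of_eventuallyEq h ?_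
  filter_upwards [hστ] with q hq
  rw [hq]

/-- The differential at `x` of the `i`-th coordinate of `σ` in the frame `coordFrame (f x)`. -/
def coeffDeriv (f : M → N) (σ : Π q : M, TangentSpace 𝓘(ℝ, E) (f q)) (x : M)
    (i : Fin (Module.finrank ℝ E)) : TangentSpace 𝓘(ℝ, E') x →L[ℝ] ℝ :=
  mvfderiv 𝓘(ℝ, E') (fun q => coordFrameCoeff (f x) i (f q) (σ q)) x

/-- A coordinate is a fixed linear form on the trivialized vector; this form of its derivative
matches the term `dw` in `pullbackCov`. -/
lemma DiffAlong.hasMFDerivAt_coeff_comp (h : DiffAlong (E' := E') f σ x)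
    (i : Fin (Module.finrank ℝ E)) :
    HasMFDerivAt 𝓘(ℝ, E') 𝓘(ℝ, ℝ) (fun q => coordFrameCoeff (f x) i (f q) (σ q)) x
      ((LinearMap.toContinuousLinearMap ((Module.finBasis ℝ E).coord i)).comp
        (mfderiv 𝓘(ℝ, E') 𝓘(ℝ, E) (fun q =>
          (trivializationAt E (TangentSpace 𝓘(ℝ, E) : N → Type _) (f x) ⟨f q, σ q⟩).2) x)) := by
  let L : E →L[ℝ] ℝ := LinearMap.toContinuousLinearMap ((Module.finBasis ℝ E).coord i)
  exact HasMFDerivAt.comp x L.hasFDerivAt.hasMFDerivAt h.coord.hasMFDerivAt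

lemma DiffAlong.hasMFDerivAt_coeff (h : DiffAlong (E' := E') f σ x)
    (i : Fin (Module.finrank ℝ E)) :
    HasMFDerivAt 𝓘(ℝ, E') 𝓘(ℝ, ℝ) (fun q => coordFrameCoeff (f x) i (f q) (σ q)) x
      (coeffDeriv f σ x i) :=
  (h.hasMFDerivAt_coeff_comp i).mdifferentiableAt.hasMFDerivAt

lemma DiffAlong.eventually_eq_sum (h : DiffAlong (E' := E') f σ x) :
    ∀ᶠ q in 𝓝 x, σ q = ∑ i, coordFrameCoeff (f x) i (f q) (σ q) • coordFrame (f x) i (f q) := by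
  filter_upwards [h.base.continuousAt.eventually (eventually_mem_baseSet (E := E) (f x))] with q hq
  exact eq_sum_coordFrame hq _

end Frame

/-! ### The pullback connection in a frame -/

section Pullback

variable {E : Type*} [NormedAddCommGroup E] [NormedSpace ℝ E] [FiniteDimensional ℝ E]
  {N : Type*} [TopologicalSpace N] [ChartedSpace E N] [IsManifold 𝓘(ℝ, E) ∞ N]
  {E' : Type*} [NormedAddCommGroup E'] [NormedSpace ℝ E']
  {M : Type*} [TopologicalSpace M] [ChartedSpace E' M]
  (cov : CovariantDerivative 𝓘(ℝ, E) E (TangentSpace 𝓘(ℝ, E) : N → Type _))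
  {f : M → N} {σ τ : Π q : M, TangentSpace 𝓘(ℝ, E) (f q)} {x : M}

/-- A covariant derivative only depends on the germ of the section. -/
lemma cov_congr {Y Z : Π y : N, TangentSpace 𝓘(ℝ, E) y} {y : N}
    (hZ : DiffAlong (E' := E) (fun p : N => p) Z y) (h : ∀ᶠ z in 𝓝 y, Y z = Z z) :
    cov Y y = cov Z y :=
  cov.isCovariantDerivativeOnUniv.congr_of_eventuallyEq (hZ.congr h) hZ univ_mem h

/-- Additivity and the Leibniz rule, by induction on `s`. Differentiability of the partial sum
travels with the formula because additivity requires it at each step. -/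
lemma cov_sum_smul {ι : Type*} (s : Finset ι) (Y : ι → Π y : N, TangentSpace 𝓘(ℝ, E) y)
    (g : ι → N → ℝ) {y : N} (g' : ι → TangentSpace 𝓘(ℝ, E) y →L[ℝ] ℝ)
    (hY : ∀ i, DiffAlong (E' := E) (fun p : N => p) (Y i) y)
    (hg : ∀ i, HasMFDerivAt 𝓘(ℝ, E) 𝓘(ℝ, ℝ) (g i) y (g' i)) :
    DiffAlong (E' := E) (fun p : N => p) (fun z => ∑ i ∈ s, g i z • Y i z) y ∧
    ∀ v : TangentSpace 𝓘(ℝ, E) y, cov (fun z => ∑ i ∈ s, g i z • Y i z) y v =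
      ∑ i ∈ s, (g' i v • Y i y + g i y • cov (Y i) y v) := by
  classical
  induction s using Finset.induction_on with
  | empty =>
    simp only [Finset.sum_empty]
    refine ⟨mdifferentiableAt_zeroSection .., fun v => ?_⟩
    have := cov.isCovariantDerivativeOnUniv.zero (x := y)
    exact congr($this v)
  | insert a s ha ih =>
    simp only [Finset.sum_insert ha]
    have h1 : DiffAlong (E' := E) (fun p : N => p) (fun z => g a z • Y a z) y :=
      MDifferentiableAt.smul_section (hg a).mdifferentiableAt (hY a)
    refine ⟨mdifferentiableAt_add_section h1 ih.1, fun v => ?_⟩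
    have h2 := cov.isCovariantDerivativeOnUniv.add h1 ih.1
    have h3 := cov.isCovariantDerivativeOnUniv.leibniz (hY a) (hg a).mdifferentiableAt
    rw [← ih.2 v]
    have h4 := congr($h2 v)
    have h5 := congr($h3 v)
    refine h4.trans ?_
    rw [add_apply]
    congr 1
    refine h5.trans ?_
    rw [mvfderiv, (hg a).mfderiv, add_apply, add_comm]
    rfl

/-- Reduces computations with `pullbackCov` to coefficients and to `cov` on the frame. -/
lemma pullbackCov_eq_sum (hσ : DiffAlong (E' := E') f σ x) (v : TangentSpace 𝓘(ℝ, E') x) :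
    pullbackCov cov f σ x v =
      ∑ i, (coeffDeriv f σ x i v • coordFrame (f x) i (f x)
        + coordFrameCoeff (f x) i (f x) (σ x) •
          cov (coordFrame (f x) i) (f x) (mfderiv 𝓘(ℝ, E') 𝓘(ℝ, E) f x v)) := by
  rw [Finset.sum_add_distrib, pullbackCov]
  simp only [add_apply, ContinuousLinearMap.comp_apply]
  congr 1
  · refine (symmL_eq_sum_coordFrame _ _ _).trans (Finset.sum_congr rfl fun i _ => ?_)
    rw [coeffDeriv, mvfderiv, (hσ.hasMFDerivAt_coeff_comp i).mfderiv]
    rfl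
  · have h := cov_sum_smul cov Finset.univ (coordFrame (f x))
      (fun i _ => coordFrameCoeff (f x) i (f x) (σ x)) (fun i => 0)
      (fun i => mdifferentiableAt_coordFrame (f x) i) (fun i => hasMFDerivAt_const _ _)
    -- The canonical extension has constant coefficients in the frame, so the Leibniz rule leaves no
    -- derivative terms.
    have h' : ∀ᶠ z in 𝓝 (f x), FiberBundle.extend E (σ x) z =
        ∑ i, coordFrameCoeff (f x) i (f x) (σ x) • coordFrame (f x) i z := by
      filter_upwards [eventually_mem_baseSet (E := E) (f x)] with z hz
      rw [FiberBundle.extend, ← Trivialization.symmL_apply (R := ℝ) _ hz]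
      exact symmL_eq_sum_coordFrame _ _ _
    rw [cov_congr cov h.1 h', h.2]
    refine Finset.sum_congr rfl fun i _ => ?_
    simp

/-- No differentiability is needed: the definition sees the field only through its value at `x` and
an `mfderiv`, both determined by the germ. -/
lemma pullbackCov_congr (hστ : ∀ᶠ q in 𝓝 x, σ q = τ q) :
    pullbackCov (E' := E') cov f σ x = pullbackCov cov f τ x := by
  have h : (fun q : M => (trivializationAt E (TangentSpace 𝓘(ℝ, E) : N → Type _) (f x)
      ⟨f q, σ q⟩).2) =ᶠ[𝓝 x] fun q : M =>
        (trivializationAt E (TangentSpace 𝓘(ℝ, E) : N → Type _) (f x) ⟨f q, τ q⟩).2 := by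
    filter_upwards [hστ] with q hq
    rw [hq]
  rw [pullbackCov, pullbackCov, h.mfderiv_eq, hστ.self_of_nhds]

lemma DiffAlong.comp {Z : Π y : N, TangentSpace 𝓘(ℝ, E) y}
    (hZ : DiffAlong (E' := E) (fun p : N => p) Z (f x))
    (hf : MDifferentiableAt 𝓘(ℝ, E') 𝓘(ℝ, E) f x) :
    DiffAlong (E' := E') f (fun q => Z (f q)) x :=
  MDifferentiableAt.comp x hZ hf

/-- The pullback connection on the restriction to `f` of a vector field on `N`. -/
theorem pullbackCov_comp {Z : Π y : N, TangentSpace 𝓘(ℝ, E) y}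
    (hZ : DiffAlong (E' := E) (fun p : N => p) Z (f x))
    (hf : MDifferentiableAt 𝓘(ℝ, E') 𝓘(ℝ, E) f x) (v : TangentSpace 𝓘(ℝ, E') x) :
    pullbackCov cov f (fun q => Z (f q)) x v =
      cov Z (f x) (mfderiv 𝓘(ℝ, E') 𝓘(ℝ, E) f x v) := by
  rw [pullbackCov_eq_sum cov (hZ.comp hf)]
  have h := cov_sum_smul cov Finset.univ (coordFrame (f x))
      (fun i z => coordFrameCoeff (f x) i z (Z z)) (coeffDeriv (fun p => p) Z (f x))
      (fun i => mdifferentiableAt_coordFrame (f x) i)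
      (fun i => hZ.hasMFDerivAt_coeff i)
  rw [cov_congr cov h.1 hZ.eventually_eq_sum, h.2]
  refine Finset.sum_congr rfl fun i _ => ?_
  have h1 := HasMFDerivAt.comp x (hZ.hasMFDerivAt_coeff i) hf.hasMFDerivAt
  congr 2
  exact congr($(h1.mfderiv) v)

end Pullback

/-! ### Metric compatibility of the pullback connection -/

section Metric

variable {E : Type*} [NormedAddCommGroup E] [NormedSpace ℝ E] [FiniteDimensional ℝ E]
  {N : Type*} [TopologicalSpace N] [ChartedSpace E N] [IsManifold 𝓘(ℝ, E) ∞ N]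
  [RiemannianBundle (fun y : N => TangentSpace 𝓘(ℝ, E) y)]
  [IsContMDiffRiemannianBundle 𝓘(ℝ, E) ∞ E (fun y : N => TangentSpace 𝓘(ℝ, E) y)]
  {E' : Type*} [NormedAddCommGroup E'] [NormedSpace ℝ E']
  {M : Type*} [TopologicalSpace M] [ChartedSpace E' M]
  {cov : CovariantDerivative 𝓘(ℝ, E) E (TangentSpace 𝓘(ℝ, E) : N → Type _)}
  {f : M → N} {σ τ : Π q : M, TangentSpace 𝓘(ℝ, E) (f q)} {x : M}

protected lemma DiffAlong.inner (hσ : DiffAlong (E' := E') f σ x) (hτ : DiffAlong (E' := E') f τ x) :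
    MDifferentiableAt 𝓘(ℝ, E') 𝓘(ℝ, ℝ) (fun q => (inner ℝ (σ q) (τ q) : ℝ)) x := by
  refine MDifferentiableAt.inner_bundle (IB := 𝓘(ℝ, E)) (F := E)
      (E := fun y : N => TangentSpace 𝓘(ℝ, E) y) ?_ ?_
  · exact hσ
  · exact hτ

/-- The pullback of the Levi-Civita connection is compatible with the metric. -/
theorem IsLeviCivita.hasMFDerivAt_inner (hcov : IsLeviCivita cov)
    (hσ : DiffAlong (E' := E') f σ x) (hτ : DiffAlong (E' := E') f τ x) :
    HasMFDerivAt 𝓘(ℝ, E') 𝓘(ℝ, ℝ) (fun q => (inner ℝ (σ q) (τ q) : ℝ)) x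
      ((innerSL ℝ (τ x)).comp (pullbackCov cov f σ x) +
        (innerSL ℝ (σ x)).comp (pullbackCov cov f τ x)) := by
  -- Compatibility on `N` applies to the frame fields themselves; the chain rule carries it to `f`.
  -- The general case is then the product rule in coordinates.
  have hg : ∀ i j, HasMFDerivAt 𝓘(ℝ, E') 𝓘(ℝ, ℝ) (fun q => (inner ℝ (coordFrame (f x) i (f q))
      (coordFrame (f x) j (f q)) : ℝ)) x
      (((innerSL ℝ (coordFrame (f x) j (f x))).comp (cov (coordFrame (f x) i) (f x)) +
        (innerSL ℝ (coordFrame (f x) i (f x))).comp (cov (coordFrame (f x) j) (f x))).comp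
          (mfderiv 𝓘(ℝ, E') 𝓘(ℝ, E) f x)) := by
    intro i j
    have h1 : MDifferentiableAt 𝓘(ℝ, E) 𝓘(ℝ, ℝ)
        (fun y => (inner ℝ (coordFrame (f x) i y) (coordFrame (f x) j y) : ℝ)) (f x) :=
      (diffAlong_coordFrame (f x) i).inner (diffAlong_coordFrame (f x) j)
    replace h1 := h1.hasMFDerivAt
    have h2 := HasMFDerivAt.comp x h1 hσ.base.hasMFDerivAt
    refine HasMFDerivAt.congr_mfderiv h2 (Eq.symm ?_)
    ext v
    have h3 := hcov.metric (f x) _ _ (mdifferentiableAt_coordFrame (f x) i)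
      (mdifferentiableAt_coordFrame (f x) j) (mfderiv 𝓘(ℝ, E') 𝓘(ℝ, E) f x v)
    refine Eq.trans ?_ h3.symm
    rw [real_inner_comm]
    rfl
  have hS := HasMFDerivAt.sum (t := Finset.univ) fun i _ => HasMFDerivAt.sum (t := Finset.univ)
    fun j _ => ((hσ.hasMFDerivAt_coeff i).mul (hτ.hasMFDerivAt_coeff j)).mul (hg i j)
  have hS' := hS.congr_of_eventuallyEq
    (f₁ := fun q => (inner ℝ (σ q) (τ q) : ℝ)) (by
      filter_upwards [hσ.eventually_eq_sum, hτ.eventually_eq_sum] with q h1 h2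
      conv_lhs => rw [h1, h2]
      simp only [sum_inner, inner_sum, real_inner_smul_left, real_inner_smul_right,
        Finset.sum_apply, Pi.mul_apply]
      rw [Finset.sum_comm]
      exact Finset.sum_congr rfl fun i _ => Finset.sum_congr rfl fun j _ => by ring)
  refine hS'.congr_mfderiv ?_
  have key : ∀ v, (inner ℝ (τ x) (pullbackCov cov f σ x v) : ℝ)
      + (inner ℝ (σ x) (pullbackCov cov f τ x v) : ℝ) = ∑ i, ∑ j,
        ((coordFrameCoeff (f x) i (f x) (σ x) * coordFrameCoeff (f x) j (f x) (τ x)) *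
          ((inner ℝ (coordFrame (f x) j (f x)) (cov (coordFrame (f x) i) (f x)
            (mfderiv 𝓘(ℝ, E') 𝓘(ℝ, E) f x v)) : ℝ) +
          (inner ℝ (coordFrame (f x) i (f x)) (cov (coordFrame (f x) j) (f x)
            (mfderiv 𝓘(ℝ, E') 𝓘(ℝ, E) f x v)) : ℝ)) +
        (inner ℝ (coordFrame (f x) i (f x)) (coordFrame (f x) j (f x)) : ℝ) *
          (coordFrameCoeff (f x) i (f x) (σ x) * coeffDeriv f τ x j v +
            coordFrameCoeff (f x) j (f x) (τ x) * coeffDeriv f σ x i v)) := by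
    intro v
    rw [real_inner_comm, pullbackCov_eq_sum cov hσ, pullbackCov_eq_sum cov hτ]
    conv_lhs =>
      enter [1]
      rw [hτ.eventually_eq_sum.self_of_nhds]
    conv_lhs =>
      enter [2]
      rw [hσ.eventually_eq_sum.self_of_nhds]
    simp only [sum_inner (𝕜 := ℝ)]
    simp only [inner_sum]
    rw [← Finset.sum_add_distrib]
    refine Finset.sum_congr rfl fun i _ => ?_
    rw [← Finset.sum_add_distrib]
    refine Finset.sum_congr rfl fun j _ => ?_
    simp only [inner_add_left, inner_add_right, real_inner_smul_left, real_inner_smul_right]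
    rw [real_inner_comm (coordFrame (f x) j (f x)) (cov (coordFrame (f x) i) (f x) _)]
    ring
  ext v
  refine Eq.trans ?_ (key v).symm
  simp only [sum_apply]
  rfl

end Metric

/-! ### Orthogonal projection in terms of an orthogonal family -/

section OrthogonalFamily

open InnerProductSpace

variable {V : Type*} [NormedAddCommGroup V] [InnerProductSpace ℝ V] [FiniteDimensional ℝ V]

/-- The difference from `v` is orthogonal to each generator. Leaving the family unnormalized keeps
the coefficients rational in inner products, so they inherit smoothness without square roots. -/
lemma starProjection_eq_sum_of_orthogonal {k : ℕ} {g : Fin k → V} {K : Submodule ℝ V}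
    (hg : ∀ i, g i ≠ 0) (ho : Pairwise fun i j => (inner ℝ (g i) (g j) : ℝ) = 0)
    (hK : Submodule.span ℝ (Set.range g) = K) (v : V) :
    K.starProjection v = ∑ i, ((inner ℝ (g i) v : ℝ) / (inner ℝ (g i) (g i) : ℝ)) • g i := by
  subst hK
  refine Submodule.eq_starProjection_of_mem_orthogonal ?_ ?_
  · exact Submodule.sum_mem _ fun i _ => Submodule.smul_mem _ _ (Submodule.subset_span ⟨i, rfl⟩)
  · rw [Submodule.mem_orthogonal]
    intro u hu
    induction hu using Submodule.span_induction with
    | mem u hu =>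
      obtain ⟨j, rfl⟩ := hu
      have h0 : (inner ℝ (g j) (g j) : ℝ) ≠ 0 := inner_self_ne_zero.2 (hg j)
      rw [inner_sub_right, inner_sum, Finset.sum_eq_single j]
      · rw [real_inner_smul_right, div_mul_cancel₀ _ h0, sub_self]
      · intro i _ hij
        rw [real_inner_smul_right, ho hij.symm, mul_zero]
      · simp
    | zero => exact inner_zero_left _
    | add a b _ _ ha hb => rw [inner_add_left, ha, hb, add_zero]
    | smul c a _ ha => rw [real_inner_smul_left, ha, mul_zero]

lemma starProjection_eq_sum_gramSchmidt {k : ℕ} {s : Fin k → V} {K : Submodule ℝ V}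
    (hs : LinearIndependent ℝ s) (hK : Submodule.span ℝ (Set.range s) = K) (v : V) :
    K.starProjection v = ∑ i, ((inner ℝ (gramSchmidt ℝ s i) v : ℝ) /
      (inner ℝ (gramSchmidt ℝ s i) (gramSchmidt ℝ s i) : ℝ)) • gramSchmidt ℝ s i :=
  starProjection_eq_sum_of_orthogonal (fun i => gramSchmidt_ne_zero i hs)
    (gramSchmidt_pairwise_orthogonal ℝ s) ((span_gramSchmidt ℝ s).trans hK) v

end OrthogonalFamily

/-! ### Smooth fields and smoothness of projections to a distribution -/

section Smooth

open InnerProductSpace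

variable {E : Type*} [NormedAddCommGroup E] [NormedSpace ℝ E] [FiniteDimensional ℝ E]
  {N : Type*} [TopologicalSpace N] [ChartedSpace E N] [IsManifold 𝓘(ℝ, E) ∞ N]

/-- Smoothness of a vector field at a point. -/
def SmoothFieldAt (Y : Π y : N, TangentSpace 𝓘(ℝ, E) y) (y : N) : Prop :=
  ContMDiffAt 𝓘(ℝ, E) 𝓘(ℝ, E).tangent ∞
    (fun p : N => (⟨p, Y p⟩ : TangentBundle 𝓘(ℝ, E) N)) y

variable {Y Z : Π y : N, TangentSpace 𝓘(ℝ, E) y} {y : N}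

lemma SmoothFieldAt.diffAlong (h : SmoothFieldAt Y y) : DiffAlong (E' := E) (fun p : N => p) Y y :=
  ContMDiffAt.mdifferentiableAt h (by simp)

lemma SmoothFieldNear.at (h : SmoothFieldNear Y y) : SmoothFieldAt Y y := h.self_of_nhds

lemma SmoothFieldAt.congr (h : SmoothFieldAt Y y) (hYZ : ∀ᶠ z in 𝓝 y, Z z = Y z) :
    SmoothFieldAt Z y := by
  refine ContMDiffAt.congr_of_eventuallyEq h ?_
  filter_upwards [hYZ] with q hq
  rw [hq]

lemma SmoothFieldAt.sub (hY : SmoothFieldAt Y y) (hZ : SmoothFieldAt Z y) :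
    SmoothFieldAt (fun p => Y p - Z p) y :=
  ContMDiffAt.sub_section hY hZ

lemma SmoothFieldAt.add (hY : SmoothFieldAt Y y) (hZ : SmoothFieldAt Z y) :
    SmoothFieldAt (fun p => Y p + Z p) y :=
  ContMDiffAt.add_section hY hZ

lemma SmoothFieldAt.smul {g : N → ℝ} (hg : ContMDiffAt 𝓘(ℝ, E) 𝓘(ℝ, ℝ) ∞ g y)
    (hY : SmoothFieldAt Y y) : SmoothFieldAt (fun p => g p • Y p) y :=
  ContMDiffAt.smul_section hg hY

lemma SmoothFieldAt.sum {ι : Type*} {s : Finset ι} {Y : ι → Π y : N, TangentSpace 𝓘(ℝ, E) y}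
    (hY : ∀ i ∈ s, SmoothFieldAt (Y i) y) : SmoothFieldAt (fun p => ∑ i ∈ s, Y i p) y :=
  ContMDiffAt.sum_section hY

lemma smoothFieldAt_extend (v : TangentSpace 𝓘(ℝ, E) y) :
    ∀ᶠ z in 𝓝 y, SmoothFieldAt (FiberBundle.extend E v) z := by
  obtain ⟨s, hs, h⟩ := FiberBundle.exists_contMDiffOn_extend (k := ∞) 𝓘(ℝ, E) E v
  filter_upwards [eventually_mem_nhds_iff.2 hs] with z hz
  exact h.contMDiffAt hz

variable [RiemannianBundle (fun y : N => TangentSpace 𝓘(ℝ, E) y)]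
  [IsContMDiffRiemannianBundle 𝓘(ℝ, E) ∞ E (fun y : N => TangentSpace 𝓘(ℝ, E) y)]

protected lemma SmoothFieldAt.inner (hY : SmoothFieldAt Y y) (hZ : SmoothFieldAt Z y) :
    ContMDiffAt 𝓘(ℝ, E) 𝓘(ℝ, ℝ) ∞ (fun p => (inner ℝ (Y p) (Z p) : ℝ)) y := by
  refine ContMDiffAt.inner_bundle (IB := 𝓘(ℝ, E)) (F := E)
      (E := fun y : N => TangentSpace 𝓘(ℝ, E) y) ?_ ?_
  · exact hY
  · exact hZ

/-- Strong induction along the recursive formula. Only nonvanishing of the denominators at `y`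
matters, so independence at that one point is enough. -/
protected lemma SmoothFieldAt.gramSchmidt {k : ℕ} {s : Fin k → Π y : N, TangentSpace 𝓘(ℝ, E) y}
    (hs : ∀ i, SmoothFieldAt (s i) y) (hli : LinearIndependent ℝ fun i => s i y) (n : Fin k) :
    SmoothFieldAt (fun p => gramSchmidt ℝ (fun i => s i p) n) y := by
  induction n using WellFoundedLT.induction with
  | ind n ih =>
    have h : ∀ p, gramSchmidt ℝ (fun i => s i p) n = s n p - ∑ i ∈ Finset.Iio n,
        ((inner ℝ (gramSchmidt ℝ (fun i => s i p) i) (s n p) : ℝ) /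
          (inner ℝ (gramSchmidt ℝ (fun i => s i p) i) (gramSchmidt ℝ (fun i => s i p) i) : ℝ)) •
            gramSchmidt ℝ (fun i => s i p) i := by
      intro p
      rw [eq_sub_iff_add_eq]
      conv_rhs => rw [gramSchmidt_def'' ℝ (fun i => s i p) n]
      congr 1
      refine Finset.sum_congr rfl fun i _ => ?_
      rw [real_inner_self_eq_norm_sq]
      rfl
    refine SmoothFieldAt.congr (Y := fun p => s n p - ∑ i ∈ Finset.Iio n,
        ((inner ℝ (gramSchmidt ℝ (fun i => s i p) i) (s n p) : ℝ) /
          (inner ℝ (gramSchmidt ℝ (fun i => s i p) i) (gramSchmidt ℝ (fun i => s i p) i) : ℝ)) •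
            gramSchmidt ℝ (fun i => s i p) i) ?_ (Eventually.of_forall h)
    refine (hs n).sub (SmoothFieldAt.sum fun i hi => ?_)
    have hi' := ih i (Finset.mem_Iio.1 hi)
    refine SmoothFieldAt.smul ?_ hi'
    exact (hi'.inner (hs n)).div₀ (hi'.inner hi')
      (inner_self_ne_zero.2 (gramSchmidt_ne_zero i hli))

/-- The orthogonal projection of a smooth field to a smooth distribution is smooth. -/
lemma SmoothDistributionNear.smoothFieldAt_starProjection
    {D : Π y : N, Submodule ℝ (TangentSpace 𝓘(ℝ, E) y)} (hD : SmoothDistributionNear D y) :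
    ∀ᶠ z in 𝓝 y, ∀ Y : Π y : N, TangentSpace 𝓘(ℝ, E) y, SmoothFieldAt Y z →
      SmoothFieldAt (fun p => (D p).starProjection (Y p)) z := by
  obtain ⟨k, s, hs, h⟩ := hD
  filter_upwards [eventually_all.2 hs, h.eventually_nhds] with z hz hz' Y hY
  have hgs := SmoothFieldAt.gramSchmidt hz hz'.self_of_nhds.1
  refine SmoothFieldAt.congr (Y := fun p => ∑ i,
    ((inner ℝ (InnerProductSpace.gramSchmidt ℝ (fun i => s i p) i) (Y p) : ℝ) /
      (inner ℝ (InnerProductSpace.gramSchmidt ℝ (fun i => s i p) i)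
        (InnerProductSpace.gramSchmidt ℝ (fun i => s i p) i) : ℝ)) •
        InnerProductSpace.gramSchmidt ℝ (fun i => s i p) i) ?_ ?_
  · refine SmoothFieldAt.sum fun i _ => SmoothFieldAt.smul ?_ (hgs i)
    exact ((hgs i).inner hY).div₀ ((hgs i).inner (hgs i))
      (inner_self_ne_zero.2 (gramSchmidt_ne_zero i hz'.self_of_nhds.1))
  · filter_upwards [hz'] with p hp
    exact starProjection_eq_sum_gramSchmidt hp.1 hp.2 (Y p)

lemma SmoothDistributionNear.smoothFieldAt_starProjection_orthogonal
    {D : Π y : N, Submodule ℝ (TangentSpace 𝓘(ℝ, E) y)} (hD : SmoothDistributionNear D y) :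
    ∀ᶠ z in 𝓝 y, ∀ Y : Π y : N, TangentSpace 𝓘(ℝ, E) y, SmoothFieldAt Y z →
      SmoothFieldAt (fun p => (D p)ᗮ.starProjection (Y p)) z := by
  filter_upwards [hD.smoothFieldAt_starProjection] with z hz Y hY
  refine (hY.sub (hz Y hY)).congr (Eventually.of_forall fun p => ?_)
  rw [Submodule.starProjection_orthogonal]
  rfl

end Smooth

/-! ### Regularity of the adjoint of `F_*` -/

section Adjoint

open InnerProductSpace

variable {EM : Type*} [NormedAddCommGroup EM] [NormedSpace ℝ EM] [FiniteDimensional ℝ EM]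
  {M : Type*} [TopologicalSpace M] [ChartedSpace EM M] [IsManifold 𝓘(ℝ, EM) ∞ M]
  [RiemannianBundle (fun q : M => TangentSpace 𝓘(ℝ, EM) q)]
  [IsContMDiffRiemannianBundle 𝓘(ℝ, EM) ∞ EM (fun q : M => TangentSpace 𝓘(ℝ, EM) q)]
  {EN : Type*} [NormedAddCommGroup EN] [NormedSpace ℝ EN] [FiniteDimensional ℝ EN]
  {N : Type*} [TopologicalSpace N] [ChartedSpace EN N] [IsManifold 𝓘(ℝ, EN) ∞ N]
  [RiemannianBundle (fun y : N => TangentSpace 𝓘(ℝ, EN) y)]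
  [IsContMDiffRiemannianBundle 𝓘(ℝ, EN) ∞ EN (fun y : N => TangentSpace 𝓘(ℝ, EN) y)]
  {F : M → N} {q : M}

protected lemma DiffAlong.dF (hF : ContMDiff 𝓘(ℝ, EM) 𝓘(ℝ, EN) ∞ F)
    {Y : Π q : M, TangentSpace 𝓘(ℝ, EM) q} (hY : DiffAlong (E' := EM) (fun p : M => p) Y q) :
    DiffAlong (E' := EM) F (fun p => dF (EM := EM) (EN := EN) F p (Y p)) q := by
  have h : ContMDiff 𝓘(ℝ, EM).tangent 𝓘(ℝ, EN).tangent ∞ (tangentMap 𝓘(ℝ, EM) 𝓘(ℝ, EN) F) :=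
    hF.contMDiff_tangentMap (by simp)
  exact MDifferentiableAt.comp q (h.mdifferentiableAt (by simp)) hY

lemma inner_adjF (F : M → N) (p : M) (v : TangentSpace 𝓘(ℝ, EM) p)
    (ξ : TangentSpace 𝓘(ℝ, EN) (F p)) :
    (inner ℝ v (adjF (EM := EM) (EN := EN) F p ξ) : ℝ)
      = inner ℝ (dF (EM := EM) (EN := EN) F p v) ξ :=
  LinearMap.adjoint_inner_right _ _ _

/-- The adjoint of `F_*` maps differentiable fields along `F` to differentiable fields. -/
protected lemma DiffAlong.adjF (hF : ContMDiff 𝓘(ℝ, EM) 𝓘(ℝ, EN) ∞ F)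
    {ξ : Π q : M, TangentSpace 𝓘(ℝ, EN) (F q)} (hξ : DiffAlong (E' := EM) F ξ q) :
    DiffAlong (E' := EM) (fun p : M => p) (fun p => adjF (EM := EM) (EN := EN) F p (ξ p)) q := by
  have hli : ∀ᶠ p in 𝓝 q, LinearIndependent ℝ (fun i => coordFrame (E := EM) q i p) ∧
      Submodule.span ℝ (Set.range fun i => coordFrame (E := EM) q i p) = ⊤ := by
    filter_upwards [eventually_mem_baseSet (E := EM) q] with p hp
    let b := (trivializationAt EM (TangentSpace 𝓘(ℝ, EM) : M → Type _) q).basisAt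
      (Module.finBasis ℝ EM) hp
    have hb : (fun i => coordFrame (E := EM) q i p) = b := by
      ext i
      rw [coordFrame]
      simp [b, Trivialization.basisAt, Trivialization.symmL_apply _ hp]
    rw [hb]
    exact ⟨b.linearIndependent, b.span_eq⟩
  have hs : ∀ i, SmoothFieldAt (coordFrame (E := EM) q i) q := fun i =>
    contMDiffAt_coordFrame q i (FiberBundle.mem_baseSet_trivializationAt' q)
  have hgs := fun i => SmoothFieldAt.gramSchmidt hs hli.self_of_nhds.1 i
  -- Expansion of the adjoint field in an orthogonal frame `g i` of `TM`, with the adjoint moved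
  -- across: `⟨g i, *F_* ξ⟩ = ⟨F_* (g i), ξ⟩`. Every term is now visibly differentiable.
  refine DiffAlong.congr (σ := fun p => ∑ i,
    ((inner ℝ (RiemMap.dF (EM := EM) (EN := EN) F p
        (gramSchmidt ℝ (fun i => coordFrame (E := EM) q i p) i)) (ξ p) : ℝ) /
      (inner ℝ (gramSchmidt ℝ (fun i => coordFrame (E := EM) q i p) i)
        (gramSchmidt ℝ (fun i => coordFrame (E := EM) q i p) i) : ℝ)) •
        gramSchmidt ℝ (fun i => coordFrame (E := EM) q i p) i) ?_ ?_
  · refine MDifferentiableAt.sum_section fun i _ => MDifferentiableAt.smul_section ?_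
      (hgs i).diffAlong
    simp only [div_eq_mul_inv]
    exact (((hgs i).diffAlong.dF hF).inner hξ).mul ((((hgs i).inner (hgs i)).inv₀
      (inner_self_ne_zero.2 (gramSchmidt_ne_zero i hli.self_of_nhds.1))).mdifferentiableAt
        (by simp))
  · filter_upwards [hli] with p hp
    have h := starProjection_eq_sum_gramSchmidt hp.1 hp.2
      (RiemMap.adjF (EM := EM) (EN := EN) F p (ξ p))
    rw [Submodule.starProjection_top] at h
    refine h.trans (Finset.sum_congr rfl fun i _ => ?_)
    rw [inner_adjF]

end Adjoint

/-! ### Vector fields and Lie brackets read in a chart -/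

section ChartField

variable {E : Type*} [NormedAddCommGroup E] [NormedSpace ℝ E] [FiniteDimensional ℝ E]
  {N : Type*} [TopologicalSpace N] [ChartedSpace E N] [IsManifold 𝓘(ℝ, E) ∞ N]

/-- The vector field `Y` read in the preferred chart at `x`. -/
def chartField (x : N) (Y : Π y : N, TangentSpace 𝓘(ℝ, E) y) (z : E) : E :=
  VectorField.mpullbackWithin 𝓘(ℝ, E) 𝓘(ℝ, E) (extChartAt 𝓘(ℝ, E) x).symm Y
    (Set.range 𝓘(ℝ, E)) z

/-- The pullback uses the inverse of the derivative of the inverse chart, and on the target this is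
the derivative of the chart. -/
lemma chartField_eq {x : N} {z : E} (hz : z ∈ (extChartAt 𝓘(ℝ, E) x).target)
    (Y : Π y : N, TangentSpace 𝓘(ℝ, E) y) :
    chartField x Y z = mfderiv 𝓘(ℝ, E) 𝓘(ℝ, E) (extChartAt 𝓘(ℝ, E) x)
      ((extChartAt 𝓘(ℝ, E) x).symm z) (Y ((extChartAt 𝓘(ℝ, E) x).symm z)) := by
  have h := ContinuousLinearMap.inverse_eq
    (mfderivWithin_extChartAt_symm_comp_mfderiv_extChartAt (I := 𝓘(ℝ, E)) hz)
    (mfderiv_extChartAt_comp_mfderivWithin_extChartAt_symm (I := 𝓘(ℝ, E)) hz)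
  exact congr($h (Y ((extChartAt 𝓘(ℝ, E) x).symm z)))

lemma chartField_extChartAt {x y : N} (hy : y ∈ (chartAt E x).source)
    (Y : Π y : N, TangentSpace 𝓘(ℝ, E) y) :
    chartField x Y (extChartAt 𝓘(ℝ, E) x y) =
      mfderiv 𝓘(ℝ, E) 𝓘(ℝ, E) (extChartAt 𝓘(ℝ, E) x) y (Y y) := by
  have hy' : y ∈ (extChartAt 𝓘(ℝ, E) x).source := by rwa [extChartAt_source]
  -- The point is generalized because the tangent space containing `Y p` depends on it.
  have h : ∀ p, p = y → (mfderiv 𝓘(ℝ, E) 𝓘(ℝ, E) (extChartAt 𝓘(ℝ, E) x) p (Y p) : E) =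
      mfderiv 𝓘(ℝ, E) 𝓘(ℝ, E) (extChartAt 𝓘(ℝ, E) x) y (Y y) := by
    rintro p rfl
    rfl
  exact (chartField_eq ((extChartAt 𝓘(ℝ, E) x).map_source hy') Y).trans
    (h _ ((extChartAt 𝓘(ℝ, E) x).left_inv hy'))

lemma chartField_self (x : N) (Y : Π y : N, TangentSpace 𝓘(ℝ, E) y) :
    chartField x Y (extChartAt 𝓘(ℝ, E) x x) = Y x := by
  rw [chartField_extChartAt (mem_chart_source E x), mfderiv_extChartAt_self]
  rfl

lemma differentiableAt_chartField {x : N} {Y : Π y : N, TangentSpace 𝓘(ℝ, E) y}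
    (hY : DiffAlong (E' := E) (fun p : N => p) Y x) :
    DifferentiableAt ℝ (chartField x Y) (extChartAt 𝓘(ℝ, E) x x) := by
  have h : MDifferentiableWithinAt 𝓘(ℝ, E) 𝓘(ℝ, E).tangent
      (fun p : N => (⟨p, Y p⟩ : TangentBundle 𝓘(ℝ, E) N)) Set.univ x :=
    MDifferentiableAt.mdifferentiableWithinAt hY
  have h' := h.differentiableWithinAt_mpullbackWithin_vectorField
  rw [Set.preimage_univ, Set.univ_inter, ModelWithCorners.range_eq_univ] at h'
  have h2 : chartField x Y = VectorField.mpullbackWithin 𝓘(ℝ, E) 𝓘(ℝ, E)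
      (extChartAt 𝓘(ℝ, E) x).symm Y Set.univ := by
    rw [← ModelWithCorners.range_eq_univ 𝓘(ℝ, E)]
    rfl
  rw [h2]
  exact differentiableWithinAt_univ.1 h'

/-- The manifold bracket is the chart bracket carried back by the derivative of the chart, which is
the identity at the chart's own base point. -/
lemma mlieBracket_eq_chartField (x : N) (Y Z : Π y : N, TangentSpace 𝓘(ℝ, E) y) :
    VectorField.mlieBracket 𝓘(ℝ, E) Y Z x =
      VectorField.lieBracket ℝ (chartField x Y) (chartField x Z) (extChartAt 𝓘(ℝ, E) x x) := by
  have h0 : VectorField.mlieBracket 𝓘(ℝ, E) Y Z x =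
      (mfderiv 𝓘(ℝ, E) 𝓘(ℝ, E) (extChartAt 𝓘(ℝ, E) x) x).inverse
        (VectorField.lieBracketWithin (E := E) ℝ (chartField x Y) (chartField x Z)
          ((extChartAt 𝓘(ℝ, E) x).symm ⁻¹' Set.univ ∩ Set.range 𝓘(ℝ, E))
          (extChartAt 𝓘(ℝ, E) x x)) := rfl
  have h1 : (mfderiv 𝓘(ℝ, E) 𝓘(ℝ, E) (extChartAt 𝓘(ℝ, E) x) x).inverse =
      ContinuousLinearMap.id ℝ (TangentSpace 𝓘(ℝ, E) x) := by
    rw [mfderiv_extChartAt_self]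
    exact ContinuousLinearMap.inverse_id
  refine h0.trans ((congr($h1 _)).trans ?_)
  have h2 : (extChartAt 𝓘(ℝ, E) x).symm ⁻¹' Set.univ ∩ Set.range 𝓘(ℝ, E) = Set.univ := by simp
  rw [h2, VectorField.lieBracketWithin_univ]
  rfl

/-- The preferred trivialization of the tangent bundle is the derivative of the chart, so constant
coordinates there are constant in the chart. Such extensions therefore commute at `x`, and zero
torsion makes `cov` symmetric on them, as with Christoffel symbols. -/
lemma chartField_extend {x : N} (v : TangentSpace 𝓘(ℝ, E) x) :
    chartField x (FiberBundle.extend E v) =ᶠ[𝓝 (extChartAt 𝓘(ℝ, E) x x)] fun _ => v := by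
  filter_upwards [extChartAt_target_mem_nhds (I := 𝓘(ℝ, E)) x] with z hz
  have hp : (extChartAt 𝓘(ℝ, E) x).symm z ∈ (chartAt E x).source := by
    rw [← extChartAt_source 𝓘(ℝ, E)]
    exact (extChartAt 𝓘(ℝ, E) x).map_target hz
  have hp' : (extChartAt 𝓘(ℝ, E) x).symm z ∈
      (trivializationAt E (TangentSpace 𝓘(ℝ, E) : N → Type _) x).baseSet := by
    rwa [TangentBundle.trivializationAt_baseSet]
  have hx' := FiberBundle.mem_baseSet_trivializationAt' (F := E)
    (E := (TangentSpace 𝓘(ℝ, E) : N → Type _)) x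
  have h1 := TangentBundle.continuousLinearMapAt_trivializationAt (I := 𝓘(ℝ, E)) hp
  have h2 := TangentBundle.continuousLinearMapAt_trivializationAt (I := 𝓘(ℝ, E))
    (mem_chart_source E x)
  rw [mfderiv_extChartAt_self] at h2
  have h3 : (trivializationAt E (TangentSpace 𝓘(ℝ, E) : N → Type _) x).continuousLinearMapAt ℝ
      ((extChartAt 𝓘(ℝ, E) x).symm z) (FiberBundle.extend E v ((extChartAt 𝓘(ℝ, E) x).symm z)) =
      (trivializationAt E (TangentSpace 𝓘(ℝ, E) : N → Type _) x).continuousLinearMapAt ℝ x v := by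
    rw [FiberBundle.extend, ← Trivialization.symmL_apply (R := ℝ) _ hp',
      Trivialization.continuousLinearMapAt_symmL _ hp',
      Trivialization.continuousLinearMapAt_apply_of_mem (R := ℝ) (hb := hx')]
  exact (chartField_eq hz _).trans ((congr($h1.symm _)).trans (h3.trans congr($h2 v)))

lemma mlieBracket_extend {x : N} (v w : TangentSpace 𝓘(ℝ, E) x) :
    VectorField.mlieBracket 𝓘(ℝ, E) (FiberBundle.extend E v) (FiberBundle.extend E w) x = 0 := by
  have h : ∀ v : TangentSpace 𝓘(ℝ, E) x,
      fderiv ℝ (chartField x (FiberBundle.extend E v)) (extChartAt 𝓘(ℝ, E) x x) = 0 :=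
    fun v => (chartField_extend v).fderiv_eq.trans (fderiv_const_apply (v : E))
  rw [mlieBracket_eq_chartField, VectorField.lieBracket, h, h]
  exact sub_self _

lemma CovariantDerivative.symm_extend {cov : CovariantDerivative 𝓘(ℝ, E) E
      (TangentSpace 𝓘(ℝ, E) : N → Type _)} (hcov : cov.torsion = 0) {x : N}
    (v w : TangentSpace 𝓘(ℝ, E) x) :
    cov (FiberBundle.extend E v) x w = cov (FiberBundle.extend E w) x v := by
  have h := cov.torsion_eq_zero_iff.1 hcov (FiberBundle.mdifferentiableAt_extend 𝓘(ℝ, E) E v)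
    (FiberBundle.mdifferentiableAt_extend 𝓘(ℝ, E) E w)
  rw [mlieBracket_extend, FiberBundle.extend_apply_self, FiberBundle.extend_apply_self,
    sub_eq_zero] at h
  exact h.symm

end ChartField

/-! ### Symmetry of the second fundamental form -/

section Symmetry

variable {EM : Type*} [NormedAddCommGroup EM] [NormedSpace ℝ EM] [FiniteDimensional ℝ EM]
  {M : Type*} [TopologicalSpace M] [ChartedSpace EM M] [IsManifold 𝓘(ℝ, EM) ∞ M]
  {EN : Type*} [NormedAddCommGroup EN] [NormedSpace ℝ EN] [FiniteDimensional ℝ EN]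
  {N : Type*} [TopologicalSpace N] [ChartedSpace EN N] [IsManifold 𝓘(ℝ, EN) ∞ N]
  {F : M → N} {q : M}

/-- `F` read in the preferred charts at `q` and `F q`. -/
def chartMap (F : M → N) (q : M) (z : EM) : EN :=
  extChartAt 𝓘(ℝ, EN) (F q) (F ((extChartAt 𝓘(ℝ, EM) q).symm z))

lemma contDiffAt_chartMap (hF : ContMDiff 𝓘(ℝ, EM) 𝓘(ℝ, EN) ∞ F) (q : M) :
    ContDiffAt ℝ ∞ (chartMap (EM := EM) (EN := EN) F q) (extChartAt 𝓘(ℝ, EM) q q) := by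
  have h := (contMDiffAt_iff.1 (hF q)).2
  simpa [contDiffWithinAt_univ] using! h

/-- The chain rule for `chartMap F q ∘ chart = chart ∘ F`, the trivialization being the derivative
of the chart of `N`. -/
lemma coord_dF_eq (hF : ContMDiff 𝓘(ℝ, EM) 𝓘(ℝ, EN) ∞ F) (q : M) :
    ∀ᶠ p in 𝓝 q, ∀ v : TangentSpace 𝓘(ℝ, EM) p,
      (trivializationAt EN (TangentSpace 𝓘(ℝ, EN) : N → Type _) (F q)
        ⟨F p, dF (EM := EM) (EN := EN) F p v⟩).2 =
      fderiv ℝ (chartMap (EM := EM) (EN := EN) F q) (extChartAt 𝓘(ℝ, EM) q p)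
        (mfderiv 𝓘(ℝ, EM) 𝓘(ℝ, EM) (extChartAt 𝓘(ℝ, EM) q) p v) := by
  have hc := hF.continuous.continuousAt (x := q)
  have hd : ∀ᶠ p in 𝓝 q, DifferentiableAt ℝ (chartMap (EM := EM) (EN := EN) F q) (extChartAt 𝓘(ℝ, EM) q p) := by
    have h1 : ∀ᶠ z in 𝓝 (extChartAt 𝓘(ℝ, EM) q q), DifferentiableAt ℝ (chartMap (EM := EM) (EN := EN) F q) z := by
      have h2 : ContDiffAt ℝ 1 (chartMap (EM := EM) (EN := EN) F q) (extChartAt 𝓘(ℝ, EM) q q) :=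
        (contDiffAt_chartMap hF q).of_le (by simp)
      filter_upwards [h2.eventually (by simp)] with z hz
      exact hz.differentiableAt (by simp)
    exact (continuousAt_extChartAt (I := 𝓘(ℝ, EM)) q).eventually h1
  filter_upwards [hd, (chartAt EM q).open_source.mem_nhds (mem_chart_source EM q),
    hc.preimage_mem_nhds ((chartAt EN (F q)).open_source.mem_nhds (mem_chart_source EN (F q)))]
    with p hp hp1 hp2 v
  have hb : F p ∈ (trivializationAt EN (TangentSpace 𝓘(ℝ, EN) : N → Type _) (F q)).baseSet := by
    rwa [TangentBundle.trivializationAt_baseSet]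
  rw [← Trivialization.continuousLinearMapAt_apply_of_mem (R := ℝ) _ hb,
    TangentBundle.continuousLinearMapAt_trivializationAt hp2]
  have h1 := mfderiv_comp p (mdifferentiableAt_extChartAt (I := 𝓘(ℝ, EN)) hp2)
    (hF.mdifferentiableAt (by simp) : MDifferentiableAt 𝓘(ℝ, EM) 𝓘(ℝ, EN) F p)
  have h2 := mfderiv_comp p hp.mdifferentiableAt
    (mdifferentiableAt_extChartAt (I := 𝓘(ℝ, EM)) hp1)
  have h3 : chartMap (EM := EM) (EN := EN) F q ∘ extChartAt 𝓘(ℝ, EM) q =ᶠ[𝓝 p] extChartAt 𝓘(ℝ, EN) (F q) ∘ F := by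
    filter_upwards [(chartAt EM q).open_source.mem_nhds hp1] with p' hp'
    rw [← extChartAt_source 𝓘(ℝ, EM)] at hp'
    simp only [chartMap, Function.comp_apply]
    rw [(extChartAt 𝓘(ℝ, EM) q).left_inv hp']
  rw [h3.mfderiv_eq, h1, mfderiv_eq_fderiv] at h2
  exact congr($h2 v)

/-- The second fundamental form is symmetric. -/
theorem secondFF_symm
    {covM : CovariantDerivative 𝓘(ℝ, EM) EM (TangentSpace 𝓘(ℝ, EM) : M → Type _)}
    {covN : CovariantDerivative 𝓘(ℝ, EN) EN (TangentSpace 𝓘(ℝ, EN) : N → Type _)}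
    (hM : covM.torsion = 0) (hN : covN.torsion = 0)
    (hF : ContMDiff 𝓘(ℝ, EM) 𝓘(ℝ, EN) ∞ F) {Y Z : Π q : M, TangentSpace 𝓘(ℝ, EM) q}
    (hY : DiffAlong (E' := EM) (fun p : M => p) Y q)
    (hZ : DiffAlong (E' := EM) (fun p : M => p) Z q) :
    secondFF covM covN F q (Z q) Y = secondFF covM covN F q (Y q) Z := by
  -- With `f = chartMap F q`, this is the product rule for `z ↦ Df(z) Y(z)`: a Hessian term plus
  -- `Df` applied to the derivative of `Y`.
  have hcoord : ∀ {Y : Π q : M, TangentSpace 𝓘(ℝ, EM) q},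
      DiffAlong (E' := EM) (fun p : M => p) Y q → ∀ v : TangentSpace 𝓘(ℝ, EM) q,
      mvfderiv 𝓘(ℝ, EM) (fun p => (trivializationAt EN (TangentSpace 𝓘(ℝ, EN) : N → Type _) (F q)
          ⟨F p, dF (EM := EM) (EN := EN) F p (Y p)⟩).2) q v =
      fderiv ℝ (fderiv ℝ (chartMap (EM := EM) (EN := EN) F q)) (extChartAt 𝓘(ℝ, EM) q q) v (Y q) +
        fderiv ℝ (chartMap (EM := EM) (EN := EN) F q) (extChartAt 𝓘(ℝ, EM) q q)
          (fderiv ℝ (chartField q Y) (extChartAt 𝓘(ℝ, EM) q q) v) := by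
    intro Y hY v
    have h1 : HasFDerivAt (fderiv ℝ (chartMap (EM := EM) (EN := EN) F q))
        (fderiv ℝ (fderiv ℝ (chartMap (EM := EM) (EN := EN) F q)) (extChartAt 𝓘(ℝ, EM) q q))
        (extChartAt 𝓘(ℝ, EM) q q) :=
      (((contDiffAt_chartMap hF q).fderiv_right (m := ∞) (by simp)).differentiableAt
        (by simp)).hasFDerivAt
    have h2 := h1.clm_apply (differentiableAt_chartField hY).hasFDerivAt
    have h3 := HasMFDerivAt.comp q h2.hasMFDerivAt
      (mdifferentiableAt_extChartAt (I := 𝓘(ℝ, EM)) (mem_chart_source EM q)).hasMFDerivAt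
    have h4 := h3.congr_of_eventuallyEq (f₁ := fun p =>
      (trivializationAt EN (TangentSpace 𝓘(ℝ, EN) : N → Type _) (F q)
          ⟨F p, dF (EM := EM) (EN := EN) F p (Y p)⟩).2) (by
      filter_upwards [coord_dF_eq hF q,
        (chartAt EM q).open_source.mem_nhds (mem_chart_source EM q)] with p hp hp'
      rw [hp, ← chartField_extChartAt hp']
      rfl)
    have h5 : mfderiv 𝓘(ℝ, EM) 𝓘(ℝ, EM) (extChartAt 𝓘(ℝ, EM) q) q v = v := by
      rw [mfderiv_extChartAt_self]
      rfl
    refine congr($(h4.mfderiv) v).trans ?_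
    refine Eq.trans ?_ (add_comm _ _)
    rw [← chartField_self q Y]
    conv_rhs => rw [← h5]
    rfl
  have hB : ∀ u : TangentSpace 𝓘(ℝ, EM) q,
      (trivializationAt EN (TangentSpace 𝓘(ℝ, EN) : N → Type _) (F q)).symmL ℝ (F q)
        (fderiv ℝ (chartMap (EM := EM) (EN := EN) F q) (extChartAt 𝓘(ℝ, EM) q q) u) =
      dF (EM := EM) (EN := EN) F q u := by
    intro u
    have h := (coord_dF_eq hF q).self_of_nhds u
    have h5 : mfderiv 𝓘(ℝ, EM) 𝓘(ℝ, EM) (extChartAt 𝓘(ℝ, EM) q) q u = u := by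
      rw [mfderiv_extChartAt_self]
      rfl
    have hb := FiberBundle.mem_baseSet_trivializationAt' (F := EN)
      (E := (TangentSpace 𝓘(ℝ, EN) : N → Type _)) (F q)
    refine (congrArg _ (h.trans (congrArg _ h5)).symm).trans ?_
    rw [Trivialization.symmL_apply _ hb]
    exact Trivialization.symm_apply_apply_mk _ hb _
  -- Three terms: the Hessian of `f`, the image of the derivative of `Y`, and the Christoffel term
  -- of `N`. The first and third are symmetric in the two vectors; the asymmetry of the second
  -- cancels that of `covM`, by zero torsion on `M`.
  have hA : ∀ {Y : Π q : M, TangentSpace 𝓘(ℝ, EM) q},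
      DiffAlong (E' := EM) (fun p : M => p) Y q → ∀ v : TangentSpace 𝓘(ℝ, EM) q,
      pullbackCov covN F (fun p => dF (EM := EM) (EN := EN) F p (Y p)) q v =
        (trivializationAt EN (TangentSpace 𝓘(ℝ, EN) : N → Type _) (F q)).symmL ℝ (F q)
          (fderiv ℝ (fderiv ℝ (chartMap (EM := EM) (EN := EN) F q))
            (extChartAt 𝓘(ℝ, EM) q q) v (Y q)) +
        dF (EM := EM) (EN := EN) F q
          (fderiv ℝ (chartField q Y) (extChartAt 𝓘(ℝ, EM) q q) v) +
        covN (FiberBundle.extend EN (dF (EM := EM) (EN := EN) F q (Y q))) (F q)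
          (dF (EM := EM) (EN := EN) F q v) := by
    intro Y hY v
    let L := (trivializationAt EN (TangentSpace 𝓘(ℝ, EN) : N → Type _) (F q)).symmL ℝ (F q)
    have h1 : pullbackCov covN F (fun p => dF (EM := EM) (EN := EN) F p (Y p)) q v =
      L (mvfderiv 𝓘(ℝ, EM) (fun p => (trivializationAt EN (TangentSpace 𝓘(ℝ, EN) : N → Type _) (F q)
          ⟨F p, dF (EM := EM) (EN := EN) F p (Y p)⟩).2) q v) +
        covN (FiberBundle.extend EN (dF (EM := EM) (EN := EN) F q (Y q))) (F q)
          (dF (EM := EM) (EN := EN) F q v) := rfl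
    exact h1.trans (congrArg (· + _) (((congrArg L (hcoord hY v)).trans (map_add L _ _)).trans
      (congrArg (_ + ·) (hB _))))
  have hsymm : IsSymmSndFDerivAt ℝ (chartMap (EM := EM) (EN := EN) F q)
      (extChartAt 𝓘(ℝ, EM) q q) :=
    (contDiffAt_chartMap hF q).isSymmSndFDerivAt (by
      rw [minSmoothness_of_isRCLikeNormedField]
      exact ENat.LEInfty.out)
  have hC := covM.torsion_eq_zero_iff.1 hM hZ hY
  rw [mlieBracket_eq_chartField, VectorField.lieBracket, chartField_self, chartField_self] at hC
  have hC' := (map_sub (dF (EM := EM) (EN := EN) F q) (covM Y q (Z q)) (covM Z q (Y q))).symm.trans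
    ((congrArg (dF (EM := EM) (EN := EN) F q) hC).trans (map_sub (dF (EM := EM) (EN := EN) F q)
      (fderiv ℝ (chartField q Y) (extChartAt 𝓘(ℝ, EM) q q) (Z q))
      (fderiv ℝ (chartField q Z) (extChartAt 𝓘(ℝ, EM) q q) (Y q))))
  rw [secondFF, secondFF, hA hY, hA hZ, CovariantDerivative.symm_extend hN]
  have hgroup : ∀ {A : Type _} [AddCommGroup A] (a b b' c d d' : A), d - d' = b - b' →
      a + b + c - d = a + b' + c - d' := by
    intro A _ a b b' c d d' h
    rw [eq_add_of_sub_eq h.symm]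
    abel
  refine Eq.trans ?_ (hgroup _ _ _ _ _ _ hC')
  exact congrArg (fun w => w + _ + _ - _) (congrArg
    ((trivializationAt EN (TangentSpace 𝓘(ℝ, EN) : N → Type _) (F q)).symmL ℝ (F q))
    (hsymm.eq (Z q) (Y q)))

end Symmetry

/-! ### Horizontal fields of a Riemannian map -/

section Horizontal

variable {EM : Type*} [NormedAddCommGroup EM] [NormedSpace ℝ EM] [FiniteDimensional ℝ EM]
  {M : Type*} [TopologicalSpace M] [ChartedSpace EM M] [IsManifold 𝓘(ℝ, EM) ∞ M]
  [RiemannianBundle (fun q : M => TangentSpace 𝓘(ℝ, EM) q)]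
  [IsContMDiffRiemannianBundle 𝓘(ℝ, EM) ∞ EM (fun q : M => TangentSpace 𝓘(ℝ, EM) q)]
  {EN : Type*} [NormedAddCommGroup EN] [NormedSpace ℝ EN] [FiniteDimensional ℝ EN]
  {N : Type*} [TopologicalSpace N] [ChartedSpace EN N] [IsManifold 𝓘(ℝ, EN) ∞ N]
  [RiemannianBundle (fun y : N => TangentSpace 𝓘(ℝ, EN) y)]
  [IsContMDiffRiemannianBundle 𝓘(ℝ, EN) ∞ EN (fun y : N => TangentSpace 𝓘(ℝ, EN) y)]
  {F : M → N} {q : M}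

lemma dF_mem_rangeF (F : M → N) (q : M) (v : TangentSpace 𝓘(ℝ, EM) q) :
    dF (EM := EM) (EN := EN) F q v ∈ rangeF (EM := EM) (EN := EN) F q :=
  LinearMap.mem_range_self _ v

lemma adjF_mem_kerF_orthogonal (F : M → N) (q : M) (ξ : TangentSpace 𝓘(ℝ, EN) (F q)) :
    adjF (EM := EM) (EN := EN) F q ξ ∈ (kerF (EM := EM) (EN := EN) F q)ᗮ := by
  rw [Submodule.mem_orthogonal]
  intro u hu
  have hu' : dF (EM := EM) (EN := EN) F q u = 0 := hu
  rw [inner_adjF, hu', inner_zero_left]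

/-- The difference `w` of the two sides is horizontal, so the isometry gives `⟨w, w⟩ = ⟨F_* w, F_*
v⟩ - ⟨w, v⟩ = 0`. -/
lemma IsRiemannianMap.adjF_dF (hF : IsRiemannianMap (EM := EM) (EN := EN) F)
    {v : TangentSpace 𝓘(ℝ, EM) q} (hv : v ∈ (kerF (EM := EM) (EN := EN) F q)ᗮ) :
    adjF (EM := EM) (EN := EN) F q (dF (EM := EM) (EN := EN) F q v) = v := by
  have hw := Submodule.sub_mem _
    (adjF_mem_kerF_orthogonal F q (dF (EM := EM) (EN := EN) F q v)) hv
  rw [← sub_eq_zero, ← inner_self_eq_zero (𝕜 := ℝ), inner_sub_right, inner_adjF,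
    hF.isometric q _ hw _ hv]
  exact sub_self _

lemma IsRiemannianMap.inner_dF (hF : IsRiemannianMap (EM := EM) (EN := EN) F)
    {v : TangentSpace 𝓘(ℝ, EM) q} (hv : v ∈ (kerF (EM := EM) (EN := EN) F q)ᗮ)
    (u : TangentSpace 𝓘(ℝ, EM) q) :
    inner ℝ (dF (EM := EM) (EN := EN) F q u) (dF (EM := EM) (EN := EN) F q v) =
      (inner ℝ u v : ℝ) := by
  rw [← inner_adjF, hF.adjF_dF hv]

lemma IsRiemannianMap.dF_adjF (hF : IsRiemannianMap (EM := EM) (EN := EN) F)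
    {ξ : TangentSpace 𝓘(ℝ, EN) (F q)} (hξ : ξ ∈ rangeF (EM := EM) (EN := EN) F q) :
    dF (EM := EM) (EN := EN) F q (adjF (EM := EM) (EN := EN) F q ξ) = ξ := by
  obtain ⟨v, rfl⟩ := hξ
  obtain ⟨a, ha, b, hb, rfl⟩ :=
    Submodule.exists_add_mem_mem_orthogonal (K := kerF (EM := EM) (EN := EN) F q) v
  have ha' : dF (EM := EM) (EN := EN) F q a = 0 := ha
  have h : dF (EM := EM) (EN := EN) F q (a + b) = dF (EM := EM) (EN := EN) F q b := by
    rw [map_add, ha', zero_add]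
  have h' : dF (EM := EM) (EN := EN) F q (adjF (EM := EM) (EN := EN) F q
      (dF (EM := EM) (EN := EN) F q (a + b))) = dF (EM := EM) (EN := EN) F q (a + b) := by
    rw [h, hF.adjF_dF hb]
  exact h'

/-- Every horizontal vector extends to a differentiable horizontal field. -/
lemma IsRiemannianMap.exists_horizontal_extension (hF : IsRiemannianMap (EM := EM) (EN := EN) F)
    {v : TangentSpace 𝓘(ℝ, EM) q} (hv : v ∈ (kerF (EM := EM) (EN := EN) F q)ᗮ) :
    ∃ Z : Π p : M, TangentSpace 𝓘(ℝ, EM) p, Z q = v ∧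
      DiffAlong (E' := EM) (fun p : M => p) Z q ∧
      ∀ p, Z p ∈ (kerF (EM := EM) (EN := EN) F p)ᗮ := by
  -- Values of the adjoint are automatically horizontal, so applying it to an extension of `F_* v`
  -- on `N` avoids projecting to the horizontal distribution.
  refine ⟨fun p => adjF (EM := EM) (EN := EN) F p
    (FiberBundle.extend EN (dF (EM := EM) (EN := EN) F q v) (F p)), ?_, ?_, fun p =>
    adjF_mem_kerF_orthogonal F p _⟩
  · have h := FiberBundle.extend_apply_self (F := EN) (dF (EM := EM) (EN := EN) F q v)
    exact (congrArg (adjF (EM := EM) (EN := EN) F q) h).trans (hF.adjF_dF hv)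
  · refine DiffAlong.adjF hF.smooth (DiffAlong.comp ?_ (hF.smooth.mdifferentiableAt (by simp)))
    exact FiberBundle.mdifferentiableAt_extend 𝓘(ℝ, EN) EN _

variable {covM : CovariantDerivative 𝓘(ℝ, EM) EM (TangentSpace 𝓘(ℝ, EM) : M → Type _)}
  {covN : CovariantDerivative 𝓘(ℝ, EN) EN (TangentSpace 𝓘(ℝ, EN) : N → Type _)}

/-- Differentiate `⟨F_* Y, F_* Z⟩ = ⟨Y, Z⟩` with the pullback connection on the left and `covM` on
the right, then subtract. -/
lemma IsRiemannianMap.inner_secondFF_skew (hF : IsRiemannianMap (EM := EM) (EN := EN) F)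
    (hM : IsLeviCivita covM) (hN : IsLeviCivita covN)
    {Y Z : Π p : M, TangentSpace 𝓘(ℝ, EM) p}
    (hY : DiffAlong (E' := EM) (fun p : M => p) Y q)
    (hZ : DiffAlong (E' := EM) (fun p : M => p) Z q)
    (hYh : ∀ᶠ p in 𝓝 q, Y p ∈ (kerF (EM := EM) (EN := EN) F p)ᗮ)
    (hZh : ∀ᶠ p in 𝓝 q, Z p ∈ (kerF (EM := EM) (EN := EN) F p)ᗮ)
    (u : TangentSpace 𝓘(ℝ, EM) q) :
    (inner ℝ (secondFF covM covN F q u Y) (dF (EM := EM) (EN := EN) F q (Z q)) : ℝ) =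
      -inner ℝ (secondFF covM covN F q u Z) (dF (EM := EM) (EN := EN) F q (Y q)) := by
  have h1 := hN.hasMFDerivAt_inner (DiffAlong.dF hF.smooth hY) (DiffAlong.dF hF.smooth hZ)
  have h2 : (fun p => (inner ℝ (dF (EM := EM) (EN := EN) F p (Y p))
      (dF (EM := EM) (EN := EN) F p (Z p)) : ℝ)) =ᶠ[𝓝 q] fun p => inner ℝ (Y p) (Z p) := by
    filter_upwards [hYh, hZh] with p h h'
    exact hF.isometric p _ h _ h'
  have h3 := congr($(h1.mfderiv.symm.trans h2.mfderiv_eq) u).trans (hM.metric q Y Z hY hZ u)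
  have h4 : (inner ℝ (dF (EM := EM) (EN := EN) F q (Z q))
        (pullbackCov covN F (fun p => dF (EM := EM) (EN := EN) F p (Y p)) q u) : ℝ) +
      inner ℝ (dF (EM := EM) (EN := EN) F q (Y q))
        (pullbackCov covN F (fun p => dF (EM := EM) (EN := EN) F p (Z p)) q u) =
      inner ℝ (covM Y q u) (Z q) + inner ℝ (Y q) (covM Z q u) := h3
  rw [secondFF, secondFF, inner_sub_left, inner_sub_left, hF.inner_dF hZh.self_of_nhds,
    hF.inner_dF hYh.self_of_nhds, real_inner_comm, real_inner_comm (dF F q (Y q))]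
  rw [real_inner_comm (covM Z q u)] at h4
  linarith

/-- The second fundamental form of a Riemannian map takes horizontal fields to the normal
bundle. -/
theorem IsRiemannianMap.secondFF_mem_orthogonal (hF : IsRiemannianMap (EM := EM) (EN := EN) F)
    (hM : IsLeviCivita covM) (hN : IsLeviCivita covN)
    {X Y : Π p : M, TangentSpace 𝓘(ℝ, EM) p}
    (hX : DiffAlong (E' := EM) (fun p : M => p) X q)
    (hY : DiffAlong (E' := EM) (fun p : M => p) Y q)
    (hXh : ∀ᶠ p in 𝓝 q, X p ∈ (kerF (EM := EM) (EN := EN) F p)ᗮ)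
    (hYh : ∀ᶠ p in 𝓝 q, Y p ∈ (kerF (EM := EM) (EN := EN) F p)ᗮ) :
    secondFF covM covN F q (X q) Y ∈ (rangeF (EM := EM) (EN := EN) F q)ᗮ := by
  rw [Submodule.mem_orthogonal']
  intro ξ hξ
  obtain ⟨Z, hZq, hZ, hZh⟩ := hF.exists_horizontal_extension (adjF_mem_kerF_orthogonal F q ξ)
  rw [← hF.dF_adjF hξ, ← hZq]
  have hs := fun {Y Z} (hY : DiffAlong (E' := EM) (fun p : M => p) Y q) hZ =>
    secondFF_symm (covM := covM) (covN := covN) hM.torsion_free hN.torsion_free hF.smooth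
      (Y := Y) (Z := Z) hY hZ
  have hk := fun {Y Z} (hY : DiffAlong (E' := EM) (fun p : M => p) Y q) hZ hYh hZh =>
    hF.inner_secondFF_skew hM hN (Y := Y) (Z := Z) hY hZ hYh hZh
  have hZh' := Eventually.of_forall (f := 𝓝 q) hZh
  -- For `T(X, Y, Z) = ⟨(∇F_*)(X, Y), F_* Z⟩`, three skew relations alternating with symmetry lead
  -- from `T(X, Y, Z)` back to its negative.
  have e1 := hk hY hZ hYh hZh' (X q)
  have e2 := hk hX hY hXh hYh (Z q)
  have e3 := hk hZ hX hZh' hXh (Y q)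
  rw [hs hZ hX, hs hY hZ] at *
  rw [hs hY hX] at *
  linarith

end Horizontal

/-! ### Curves, constant speed and geodesics -/

section Curve

variable {E : Type*} [NormedAddCommGroup E] [NormedSpace ℝ E] [FiniteDimensional ℝ E]
  {N : Type*} [TopologicalSpace N] [ChartedSpace E N] [IsManifold 𝓘(ℝ, E) ∞ N]
  {γ : ℝ → N} {I : Set ℝ} {t : ℝ}

/-- The velocity is the tangent map composed with `s ↦ (s, 1)`. The tangent map is taken within `I`,
where alone `γ` is known to be smooth. -/
lemma diffAlong_velocity (hγ : ContMDiffOn 𝓘(ℝ, ℝ) 𝓘(ℝ, E) ∞ γ I) (hI : IsOpen I) (ht : t ∈ I) :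
    DiffAlong (E' := ℝ) (E := E) γ (fun s => velocity γ s) t := by
  have h1 := hγ.contMDiffOn_tangentMapWithin (m := 1) (by rw [one_add_one_eq_two]; exact ENat.LEInfty.out) hI.uniqueMDiffOn
  have h2 : ContMDiffAt 𝓘(ℝ, ℝ) 𝓘(ℝ, ℝ).tangent 1
      (fun s : ℝ => (⟨s, (1 : ℝ)⟩ : TangentBundle 𝓘(ℝ, ℝ) ℝ)) t :=
    contMDiffAt_vectorSpace_iff_contDiffAt.2 contDiffAt_const
  have h3 := h1.contMDiffAt (x := (⟨t, (1 : ℝ)⟩ : TangentBundle 𝓘(ℝ, ℝ) ℝ))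
    ((hI.preimage (FiberBundle.continuous_proj ℝ (TangentSpace 𝓘(ℝ, ℝ) : ℝ → Type _))).mem_nhds ht)
  have h4 := ContMDiffAt.comp t h3 h2
  refine MDifferentiableAt.congr_of_eventuallyEq (h4.mdifferentiableAt (by simp)) ?_
  filter_upwards [hI.mem_nhds ht] with s hs
  have h5 := mfderivWithin_of_isOpen (I := 𝓘(ℝ, ℝ)) (I' := 𝓘(ℝ, E)) (f := γ) hI hs
  exact congrArg (fun L : TangentSpace 𝓘(ℝ, ℝ) s →L[ℝ] TangentSpace 𝓘(ℝ, E) (γ s) =>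
    (⟨γ s, L (1 : ℝ)⟩ : TangentBundle 𝓘(ℝ, E) N)) h5.symm

lemma acceleration_eq_zero_of_velocity
    (cov : CovariantDerivative 𝓘(ℝ, E) E (TangentSpace 𝓘(ℝ, E) : N → Type _))
    (hγ : MDifferentiableAt 𝓘(ℝ, ℝ) 𝓘(ℝ, E) γ t)
    (h : ∀ᶠ s in 𝓝 t, velocity (E := E) γ s = 0) : acceleration cov γ t = 0 := by
  have h1 := pullbackCov_congr (E' := ℝ) cov (f := γ) (τ := fun _ => 0) h
  have h2 : DiffAlong (E' := E) (fun p : N => p) (fun p : N => (0 : TangentSpace 𝓘(ℝ, E) p)) (γ t) :=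
    mdifferentiableAt_zeroSection ..
  have h3 := pullbackCov_comp cov h2 hγ (1 : ℝ)
  have h4 := cov.isCovariantDerivativeOnUniv.zero (x := γ t)
  exact (congr($h1 (1 : ℝ))).trans (h3.trans congr($h4 _))

variable [RiemannianBundle (fun y : N => TangentSpace 𝓘(ℝ, E) y)]
  [IsContMDiffRiemannianBundle 𝓘(ℝ, E) ∞ E (fun y : N => TangentSpace 𝓘(ℝ, E) y)]
  {cov : CovariantDerivative 𝓘(ℝ, E) E (TangentSpace 𝓘(ℝ, E) : N → Type _)}

/-- A curve on an open interval is a geodesic as soon as its acceleration vanishes wherever its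
velocity does not. -/
theorem IsLeviCivita.isGeodesicOn (hcov : IsLeviCivita cov)
    (hγ : ContMDiffOn 𝓘(ℝ, ℝ) 𝓘(ℝ, E) ∞ γ I) (hI : IsOpen I) (hI' : I.OrdConnected)
    (h : ∀ t ∈ I, velocity (E := E) γ t ≠ 0 → acceleration cov γ t = 0) :
    IsGeodesicOn cov γ I := by
  -- The derivative of the squared speed is `2⟨γ', ∇_{γ'} γ'⟩`: one factor vanishes at each time.
  have hd : ∀ t ∈ I, HasFDerivAt
      (fun s => (inner ℝ (velocity (E := E) γ s) (velocity (E := E) γ s) : ℝ))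
      (0 : ℝ →L[ℝ] ℝ) t := by
    intro t ht
    have h1 := diffAlong_velocity hγ hI ht
    have h2 := hcov.hasMFDerivAt_inner h1 h1
    have h3 : (inner ℝ (velocity (E := E) γ t) (acceleration cov γ t) : ℝ) = 0 := by
      by_cases hv : velocity (E := E) γ t = 0
      · rw [hv, inner_zero_left]
      · rw [h t ht hv, inner_zero_right]
    refine (hasMFDerivAt_iff_hasFDerivAt.1 h2).congr_fderiv ?_
    ext
    have h4 : (inner ℝ (velocity (E := E) γ t) (acceleration cov γ t) : ℝ) +
      inner ℝ (velocity (E := E) γ t) (acceleration cov γ t) = 0 := by rw [h3, add_zero]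
    exact h4
  have hconst : ∀ s ∈ I, ∀ t ∈ I,
      (inner ℝ (velocity (E := E) γ s) (velocity (E := E) γ s) : ℝ) =
        inner ℝ (velocity (E := E) γ t) (velocity (E := E) γ t) := fun s hs t ht =>
    hI.is_const_of_fderiv_eq_zero (𝕜 := ℝ) hI'.isPreconnected
      (fun t ht => (hd t ht).differentiableAt.differentiableWithinAt)
      (fun t ht => (hd t ht).fderiv) hs ht
  refine ⟨hγ, fun t ht => ?_⟩
  -- By constancy, one zero of the velocity forces it to vanish near `t`, and then the acceleration
  -- is zero too.
  by_cases hv : velocity (E := E) γ t = 0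
  · refine acceleration_eq_zero_of_velocity cov
      ((hγ.contMDiffAt (hI.mem_nhds ht)).mdifferentiableAt (by simp)) ?_
    filter_upwards [hI.mem_nhds ht] with s hs
    have h1 := hconst s hs t ht
    rw [hv, inner_zero_left] at h1
    exact inner_self_eq_zero.1 h1
  · exact h t ht hv

end Curve

/-! ### The distribution `D`, its complement and the components of `P` -/

section Distribution

variable {E : Type*} [NormedAddCommGroup E] [NormedSpace ℝ E] [FiniteDimensional ℝ E]
  {N : Type*} [TopologicalSpace N] [ChartedSpace E N] [IsManifold 𝓘(ℝ, E) ∞ N]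
  [RiemannianBundle (fun y : N => TangentSpace 𝓘(ℝ, E) y)]
  [IsContMDiffRiemannianBundle 𝓘(ℝ, E) ∞ E (fun y : N => TangentSpace 𝓘(ℝ, E) y)]
  {cov : CovariantDerivative 𝓘(ℝ, E) E (TangentSpace 𝓘(ℝ, E) : N → Type _)}
  {P : Π y : N, TangentSpace 𝓘(ℝ, E) y →L[ℝ] TangentSpace 𝓘(ℝ, E) y}
  {D : Π y : N, Submodule ℝ (TangentSpace 𝓘(ℝ, E) y)}
  {V W : Π y : N, TangentSpace 𝓘(ℝ, E) y} {y : N}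

lemma IsKahler.smoothFieldAt (hP : IsKahler cov P) (hW : SmoothFieldAt W y) :
    SmoothFieldAt (fun p => P p (W p)) y :=
  ContMDiffAt.clm_bundle_apply (F₁ := E) (F₂ := E) (E₁ := fun y : N => TangentSpace 𝓘(ℝ, E) y)
    (E₂ := fun y : N => TangentSpace 𝓘(ℝ, E) y) (hP.smooth y) hW

lemma IsKahler.smoothFieldNear_tanPart (hP : IsKahler cov P) (hD : SmoothDistributionNear D y)
    (hW : SmoothFieldNear W y) : SmoothFieldNear (tanPart P D W) y := by
  filter_upwards [hD.smoothFieldAt_starProjection, hW] with z hz hWz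
  exact hz _ (hP.smoothFieldAt hWz)

lemma IsKahler.smoothFieldNear_norPart (hP : IsKahler cov P) (hD : SmoothDistributionNear D y)
    (hW : SmoothFieldNear W y) : SmoothFieldNear (norPart P D W) y := by
  filter_upwards [hD.smoothFieldAt_starProjection_orthogonal, hW] with z hz hWz
  exact hz _ (hP.smoothFieldAt hWz)

lemma tanPart_mem (z : N) : tanPart P D W z ∈ D z :=
  Submodule.starProjection_apply_mem _ _

lemma norPart_mem (z : N) : norPart P D W z ∈ (D z)ᗮ :=
  Submodule.starProjection_apply_mem _ _

lemma tanPart_add_norPart (z : N) : tanPart P D W z + norPart P D W z = P z (W z) := by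
  rw [tanPart, norPart, Submodule.starProjection_orthogonal]
  exact add_sub_cancel _ _

/-- If the normal distribution is totally geodesic, then normal derivatives of tangential fields
are tangential. -/
lemma NormalTotallyGeodesicNear.cov_mem (hgeo : NormalTotallyGeodesicNear cov D y)
    (hcov : IsLeviCivita cov) (hD : SmoothDistributionNear D y)
    (hW : SmoothFieldNear W y) (hV : SmoothFieldNear V y)
    (hWD : ∀ᶠ z in 𝓝 y, W z ∈ D z) (hVD : ∀ᶠ z in 𝓝 y, V z ∈ (D z)ᗮ) :
    cov W y (V y) ∈ D y := by
  rw [← Submodule.orthogonal_orthogonal (D y), Submodule.mem_orthogonal']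
  intro u hu
  -- A normal field through `u`. Differentiating `⟨W, U⟩ = 0` along `V` gives `⟨∇_V W, u⟩ = -⟨W, ∇_V
  -- U⟩`, and `∇_V U` is normal.
  let U : Π z : N, TangentSpace 𝓘(ℝ, E) z :=
    fun z => (D z)ᗮ.starProjection (FiberBundle.extend E u z)
  have hU : SmoothFieldNear U y := by
    filter_upwards [hD.smoothFieldAt_starProjection_orthogonal, smoothFieldAt_extend u] with z hz hz'
    exact hz _ hz'
  have hUy : U y = u := by
    have h := FiberBundle.extend_apply_self (F := E) u
    exact (congrArg (D y)ᗮ.starProjection h).trans (Submodule.starProjection_eq_self_iff.2 hu)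
  have hUD : ∀ z, U z ∈ (D z)ᗮ := fun z => Submodule.starProjection_apply_mem _ _
  have h1 := hcov.metric y W U hW.at.diffAlong hU.at.diffAlong (V y)
  have h2 : (fun p => (inner ℝ (W p) (U p) : ℝ)) =ᶠ[𝓝 y] fun _ => 0 := by
    filter_upwards [hWD] with z hz
    exact Submodule.inner_right_of_mem_orthogonal hz (hUD z)
  have h3 := hgeo.self_of_nhds V U hV hU (hVD.mono fun z hz => ⟨hz, hUD z⟩)
  have h4 := congr($(h2.mfderiv_eq (I := 𝓘(ℝ, E)) (I' := 𝓘(ℝ, ℝ))) (V y))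
  rw [mfderiv_const] at h4
  have h5 := h1.symm.trans h4
  rw [Submodule.inner_right_of_mem_orthogonal hWD.self_of_nhds h3, add_zero, hUy] at h5
  exact h5

end Distribution

/-! ### The two equations as components of `P` applied to the acceleration -/

section Equations

variable {EM : Type*} [NormedAddCommGroup EM] [NormedSpace ℝ EM] [FiniteDimensional ℝ EM]
  {M : Type*} [TopologicalSpace M] [ChartedSpace EM M] [IsManifold 𝓘(ℝ, EM) ∞ M]
  [RiemannianBundle (fun q : M => TangentSpace 𝓘(ℝ, EM) q)]
  [IsContMDiffRiemannianBundle 𝓘(ℝ, EM) ∞ EM (fun q : M => TangentSpace 𝓘(ℝ, EM) q)]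
  {EN : Type*} [NormedAddCommGroup EN] [NormedSpace ℝ EN] [FiniteDimensional ℝ EN]
  {N : Type*} [TopologicalSpace N] [ChartedSpace EN N] [IsManifold 𝓘(ℝ, EN) ∞ N]
  [RiemannianBundle (fun y : N => TangentSpace 𝓘(ℝ, EN) y)]
  [IsContMDiffRiemannianBundle 𝓘(ℝ, EN) ∞ EN (fun y : N => TangentSpace 𝓘(ℝ, EN) y)]
  {covM : CovariantDerivative 𝓘(ℝ, EM) EM (TangentSpace 𝓘(ℝ, EM) : M → Type _)}
  {covN : CovariantDerivative 𝓘(ℝ, EN) EN (TangentSpace 𝓘(ℝ, EN) : N → Type _)}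
  {P : Π y : N, TangentSpace 𝓘(ℝ, EN) y →L[ℝ] TangentSpace 𝓘(ℝ, EN) y}
  {F : M → N} {α : ℝ → M} {t : ℝ} {q : M}
  {D : Π y : N, Submodule ℝ (TangentSpace 𝓘(ℝ, EN) y)}

/-- The Gauss formula for a section of the range distribution. -/
lemma IsRiemannianMap.dF_cov_adjF_add_secondFF (hF : IsRiemannianMap (EM := EM) (EN := EN) F)
    (hD : IsRangeDistribution (EM := EM) F q D) {Z : Π y : N, TangentSpace 𝓘(ℝ, EN) y}
    (hZ : SmoothFieldAt Z (F q)) (hZD : ∀ᶠ y in 𝓝 (F q), Z y ∈ D y)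
    (u : TangentSpace 𝓘(ℝ, EM) q) :
    dF (EM := EM) (EN := EN) F q (covM (fun p => adjF (EM := EM) (EN := EN) F p (Z (F p))) q u) +
      secondFF covM covN F q u (fun p => adjF (EM := EM) (EN := EN) F p (Z (F p))) =
      covN Z (F q) (dF (EM := EM) (EN := EN) F q u) := by
  have h : ∀ᶠ p in 𝓝 q, dF (EM := EM) (EN := EN) F p
      (adjF (EM := EM) (EN := EN) F p (Z (F p))) = Z (F p) := by
    filter_upwards [hD.eq_range, hF.smooth.continuous.continuousAt.eventually hZD] with p hp hp'
    exact hF.dF_adjF (hp ▸ hp')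
  rw [secondFF, add_sub_cancel, pullbackCov_congr covN h]
  exact pullbackCov_comp covN hZ.diffAlong (hF.smooth.mdifferentiableAt (by simp)) u

/-- The Weingarten formula for a normal field. -/
lemma normalCov_sub_shapeOp (hF : ContMDiff 𝓘(ℝ, EM) 𝓘(ℝ, EN) ∞ F)
    {Z : Π y : N, TangentSpace 𝓘(ℝ, EN) y} (hZ : SmoothFieldAt Z (F q))
    (u : TangentSpace 𝓘(ℝ, EM) q) :
    normalCov (EM := EM) covN F (fun p => Z (F p)) q u -
      shapeOp (EM := EM) covN F (fun p => Z (F p)) q u =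
      covN Z (F q) (dF (EM := EM) (EN := EN) F q u) := by
  rw [normalCov, shapeOp, sub_neg_eq_add, Submodule.starProjection_orthogonal]
  exact (sub_add_cancel _ _).trans
    (pullbackCov_comp covN hZ.diffAlong (hF.mdifferentiableAt (by simp)) u)

namespace VelocityComponents

/-- The velocity is the restriction to `F ∘ α` of a field on `N`, so the pullback connection reduces
to `covN`. -/
lemma acceleration_eq (c : VelocityComponents (EM := EM) F α t D)
    (hF : ContMDiff 𝓘(ℝ, EM) 𝓘(ℝ, EN) ∞ F) (hα : MDifferentiableAt 𝓘(ℝ, ℝ) 𝓘(ℝ, EM) α t) :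
    acceleration covN (fun s => F (α s)) t =
      covN (fun y => c.W y + c.V y) (F (α t)) (c.W (F (α t)) + c.V (F (α t))) := by
  have h1 := pullbackCov_congr (E' := ℝ) covN (f := fun s => F (α s))
    (τ := fun s => c.W (F (α s)) + c.V (F (α s))) c.velocity_eq
  have h2 := pullbackCov_comp (E' := ℝ) (x := t) (f := fun s => F (α s)) covN
    (c.smooth_W.at.add c.smooth_V.at).diffAlong
    (MDifferentiableAt.comp t (hF.mdifferentiableAt (by simp)) hα) (1 : ℝ)
  exact (congr($h1 (1 : ℝ))).trans (h2.trans
    (congrArg (covN (fun y => c.W y + c.V y) (F (α t))) c.velocity_eq.self_of_nhds))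

/-- `P` commutes with the derivative because it is parallel; then `P W = φW + ωW` and `P V = BV +
CV`. -/
lemma map_cov_add_eq (c : VelocityComponents (EM := EM) F α t D) (hP : IsKahler covN P)
    (hD : SmoothDistributionNear D (F (α t))) (v : TangentSpace 𝓘(ℝ, EN) (F (α t))) :
    P (F (α t)) (covN (fun y => c.W y + c.V y) (F (α t)) v) =
      covN (tanPart P D c.W) (F (α t)) v + covN (norPart P D c.W) (F (α t)) v +
        (covN (tanPart P D c.V) (F (α t)) v + covN (norPart P D c.V) (F (α t)) v) := by
  have hφ := (hP.smoothFieldNear_tanPart hD c.smooth_W).at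
  have hω := (hP.smoothFieldNear_norPart hD c.smooth_W).at
  have hB := (hP.smoothFieldNear_tanPart hD c.smooth_V).at
  have hC := (hP.smoothFieldNear_norPart hD c.smooth_V).at
  have h1 := hP.parallel (F (α t)) _ (c.smooth_W.at.add c.smooth_V.at).diffAlong v
  have h2 := cov_congr covN ((hφ.add hω).add (hB.add hC)).diffAlong
    (Y := fun p => P p (c.W p + c.V p)) (Eventually.of_forall fun z => by
      rw [tanPart_add_norPart, tanPart_add_norPart, map_add])
  have hadd : ∀ {Y Z : Π y : N, TangentSpace 𝓘(ℝ, EN) y}, SmoothFieldAt Y (F (α t)) →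
      SmoothFieldAt Z (F (α t)) → covN (fun p => Y p + Z p) (F (α t)) v =
        covN Y (F (α t)) v + covN Z (F (α t)) v := fun hY hZ =>
    congr($(covN.isCovariantDerivativeOnUniv.add hY.diffAlong hZ.diffAlong) v)
  rw [← h1, h2, hadd (hφ.add hω) (hB.add hC), hadd hφ hω, hadd hB hC]

/-- The two left-hand sides add up to `P` applied to the acceleration. -/
lemma tangentialLHS_add_normalLHS (c : VelocityComponents (EM := EM) F α t D)
    (hP : IsKahler covN P) (hF : IsRiemannianMap (EM := EM) (EN := EN) F)
    (hD : IsRangeDistribution (EM := EM) F (α t) D)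
    (hgeo : NormalTotallyGeodesicNear covN D (F (α t)))
    (hα : MDifferentiableAt 𝓘(ℝ, ℝ) 𝓘(ℝ, EM) α t) :
    c.tangentialLHS covM covN P + c.normalLHS covM covN P =
      P (F (α t)) (acceleration covN (fun s => F (α s)) t) := by
  have hφ := (hP.smoothFieldNear_tanPart hD.smooth c.smooth_W)
  have hω := (hP.smoothFieldNear_norPart hD.smooth c.smooth_W)
  have hB := (hP.smoothFieldNear_tanPart hD.smooth c.smooth_V)
  have hC := (hP.smoothFieldNear_norPart hD.smooth c.smooth_V)
  have hu := c.related.self_of_nhds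
  have e1 := hF.dF_cov_adjF_add_secondFF (covM := covM) (covN := covN) hD hφ.at
    (Eventually.of_forall tanPart_mem) (c.X (α t))
  have e2 := hF.dF_cov_adjF_add_secondFF (covM := covM) (covN := covN) hD hB.at
    (Eventually.of_forall tanPart_mem) (c.X (α t))
  have e3 := normalCov_sub_shapeOp (covN := covN) hF.smooth hω.at (c.X (α t))
  have e4 := normalCov_sub_shapeOp (covN := covN) hF.smooth hC.at (c.X (α t))
  rw [hu] at e1 e2 e3 e4
  -- In the direction `V`, projecting the derivative of a normal field to the normal space loses
  -- nothing.
  have hn : ∀ {Z : Π y : N, TangentSpace 𝓘(ℝ, EN) y}, SmoothFieldNear Z (F (α t)) →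
      (∀ z, Z z ∈ (D z)ᗮ) → normalCovTarget (EM := EM) covN F Z (α t) (c.V (F (α t))) =
        covN Z (F (α t)) (c.V (F (α t))) := by
    intro Z hZ hZD
    have h := hgeo.self_of_nhds c.V Z c.smooth_V hZ (c.normal.mono fun z hz => ⟨hz, hZD z⟩)
    rw [hD.eq_range.self_of_nhds] at h
    exact Submodule.starProjection_eq_self_iff.2 h
  have e5 := hn hω norPart_mem
  have e6 := hn hC norPart_mem
  rw [c.acceleration_eq hF.smooth hα, c.map_cov_add_eq hP hD.smooth, map_add, map_add, map_add,
    map_add, ← e1, ← e2, ← e3, ← e4, ← e5, ← e6, tangentialLHS, normalLHS]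
  abel

/-- Only `∇_V φW` and `∇_V BV` are not tangential by construction; for them
`NormalTotallyGeodesicNear.cov_mem` is used. -/
lemma tangentialLHS_mem (c : VelocityComponents (EM := EM) F α t D)
    (hP : IsKahler covN P) (hN : IsLeviCivita covN)
    (hD : IsRangeDistribution (EM := EM) F (α t) D)
    (hgeo : NormalTotallyGeodesicNear covN D (F (α t))) :
    c.tangentialLHS covM covN P ∈ rangeF (EM := EM) (EN := EN) F (α t) := by
  have hS : ∀ Z : Π p : M, TangentSpace 𝓘(ℝ, EN) (F p), shapeOp (EM := EM) covN F Z (α t)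
      (c.X (α t)) ∈ rangeF (EM := EM) (EN := EN) F (α t) := fun Z =>
    neg_mem (Submodule.starProjection_apply_mem _ _)
  have hV : ∀ {Y : Π y : N, TangentSpace 𝓘(ℝ, EN) y}, SmoothFieldNear Y (F (α t)) →
      covN (tanPart P D Y) (F (α t)) (c.V (F (α t))) ∈ rangeF (EM := EM) (EN := EN) F (α t) := by
    intro Y hY
    rw [← hD.eq_range.self_of_nhds]
    exact hgeo.cov_mem hN hD.smooth (hP.smoothFieldNear_tanPart hD.smooth hY) c.smooth_V
      (Eventually.of_forall tanPart_mem) c.normal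
  exact add_mem (add_mem (add_mem (sub_mem (add_mem (neg_mem (hS _)) (dF_mem_rangeF F _ _))
    (hS _)) (hV c.smooth_W)) (hV c.smooth_V)) (dF_mem_rangeF F _ _)

/-- Four terms are normal projections; the two values of `∇F_*` have horizontal arguments, since the
adjoint takes horizontal values. -/
lemma normalLHS_mem (c : VelocityComponents (EM := EM) F α t D)
    (hP : IsKahler covN P) (hM : IsLeviCivita covM) (hN : IsLeviCivita covN)
    (hF : IsRiemannianMap (EM := EM) (EN := EN) F)
    (hD : IsRangeDistribution (EM := EM) F (α t) D) :
    c.normalLHS covM covN P ∈ (rangeF (EM := EM) (EN := EN) F (α t))ᗮ := by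
  have hS : ∀ {Y : Π y : N, TangentSpace 𝓘(ℝ, EN) y}, SmoothFieldNear Y (F (α t)) →
      secondFF covM covN F (α t) (c.X (α t))
        (fun p => adjF (EM := EM) (EN := EN) F p (tanPart P D Y (F p))) ∈
      (rangeF (EM := EM) (EN := EN) F (α t))ᗮ := by
    intro Y hY
    have hY' := (hP.smoothFieldNear_tanPart hD.smooth hY).at.diffAlong
    exact hF.secondFF_mem_orthogonal hM hN c.smooth_X.at.diffAlong
      (DiffAlong.adjF hF.smooth (hY'.comp (hF.smooth.mdifferentiableAt (by simp)))) c.horizontal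
      (Eventually.of_forall fun p => adjF_mem_kerF_orthogonal F p _)
  exact add_mem (add_mem (add_mem (add_mem (add_mem (hS c.smooth_W)
    (Submodule.starProjection_apply_mem _ _)) (hS c.smooth_V))
    (Submodule.starProjection_apply_mem _ _)) (Submodule.starProjection_apply_mem _ _))
    (Submodule.starProjection_apply_mem _ _)

/-- The acceleration vanishes exactly when both equations hold. -/
theorem acceleration_eq_zero_iff (c : VelocityComponents (EM := EM) F α t D)
    (hP : IsKahler covN P) (hM : IsLeviCivita covM) (hN : IsLeviCivita covN)
    (hF : IsRiemannianMap (EM := EM) (EN := EN) F)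
    (hD : IsRangeDistribution (EM := EM) F (α t) D)
    (hgeo : NormalTotallyGeodesicNear covN D (F (α t)))
    (hα : MDifferentiableAt 𝓘(ℝ, ℝ) 𝓘(ℝ, EM) α t) :
    acceleration covN (fun s => F (α s)) t = 0 ↔
      c.tangentialLHS covM covN P = 0 ∧ c.normalLHS covM covN P = 0 := by
  have hsum := c.tangentialLHS_add_normalLHS (covM := covM) hP hF hD hgeo hα
  have hT := c.tangentialLHS_mem (covM := covM) hP hN hD hgeo
  have hR := c.normalLHS_mem hP hM hN hF hD
  constructor
  · intro h
    rw [h, map_zero] at hsum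
    have h1 : c.tangentialLHS covM covN P = 0 := by
      -- Being minus the normal side, the tangential side is orthogonal to itself.
      have h2 : c.tangentialLHS covM covN P ∈ (rangeF (EM := EM) (EN := EN) F (α t))ᗮ := by
        rw [eq_neg_of_add_eq_zero_left hsum]
        exact neg_mem hR
      exact inner_self_eq_zero.1 (Submodule.inner_right_of_mem_orthogonal (𝕜 := ℝ) hT h2)
    rw [h1, zero_add] at hsum
    exact ⟨h1, hsum⟩
  · rintro ⟨h1, h2⟩
    rw [h1, h2, add_zero] at hsum
    -- `P² = -1` makes `P` injective.
    rw [← neg_eq_zero, ← hP.sq, ← hsum, map_zero]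

end VelocityComponents

end Equations

end RiemMap

end

theorem mainTheorem8
    {EM : Type*} [NormedAddCommGroup EM] [NormedSpace ℝ EM] [FiniteDimensional ℝ EM]
    {M : Type*} [TopologicalSpace M] [ChartedSpace EM M] [IsManifold 𝓘(ℝ, EM) ∞ M]
    [RiemannianBundle (fun q : M => TangentSpace 𝓘(ℝ, EM) q)]
    [IsContMDiffRiemannianBundle 𝓘(ℝ, EM) ∞ EM (fun q : M => TangentSpace 𝓘(ℝ, EM) q)]
    {EN : Type*} [NormedAddCommGroup EN] [NormedSpace ℝ EN] [FiniteDimensional ℝ EN]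
    {N : Type*} [TopologicalSpace N] [ChartedSpace EN N] [IsManifold 𝓘(ℝ, EN) ∞ N]
    [RiemannianBundle (fun y : N => TangentSpace 𝓘(ℝ, EN) y)]
    [IsContMDiffRiemannianBundle 𝓘(ℝ, EN) ∞ EN (fun y : N => TangentSpace 𝓘(ℝ, EN) y)]
    (covM : CovariantDerivative 𝓘(ℝ, EM) EM (TangentSpace 𝓘(ℝ, EM) : M → Type _))
    (covN : CovariantDerivative 𝓘(ℝ, EN) EN (TangentSpace 𝓘(ℝ, EN) : N → Type _))
    (hcovM : RiemMap.IsLeviCivita covM) (hcovN : RiemMap.IsLeviCivita covN)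
    (P : Π y : N, TangentSpace 𝓘(ℝ, EN) y →L[ℝ] TangentSpace 𝓘(ℝ, EN) y)
    (hP : RiemMap.IsKahler covN P)
    (F : M → N) (hF : RiemMap.IsSemiInvariantRiemannianMap (EM := EM) P F)
    (D : Π (_ : M) (y : N), Submodule ℝ (TangentSpace 𝓘(ℝ, EN) y))
    (hD : ∀ q, RiemMap.IsRangeDistribution (EM := EM) F q (D q))
    (hgeo : ∀ q, RiemMap.NormalTotallyGeodesicNear covN (D q) (F q))
    (I : Set ℝ) (hI : IsOpen I) (hI' : I.OrdConnected)
    (α : ℝ → M) (hα : RiemMap.IsGeodesicOn covM α I)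
    (c : ∀ t ∈ I, RiemMap.velocity (E := EN) (fun s => F (α s)) t ≠ 0 →
      RiemMap.VelocityComponents (EM := EM) F α t (D (α t))) :
    RiemMap.IsGeodesicOn covN (fun s => F (α s)) I ↔
      ∀ (t : ℝ) (ht : t ∈ I) (hv : RiemMap.velocity (E := EN) (fun s => F (α s)) t ≠ 0),
        (c t ht hv).tangentialLHS covM covN P = 0 ∧ (c t ht hv).normalLHS covM covN P = 0 := by
  have hβ : ContMDiffOn 𝓘(ℝ, ℝ) 𝓘(ℝ, EN) ∞ (fun s => F (α s)) I :=
    hF.smooth.comp_contMDiffOn hα.1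
  have key := fun (t : ℝ) (ht : t ∈ I)
      (hv : RiemMap.velocity (E := EN) (fun s => F (α s)) t ≠ 0) =>
    (c t ht hv).acceleration_eq_zero_iff hP hcovM hcovN hF.toIsRiemannianMap (hD (α t))
      (hgeo (α t)) ((hα.1.contMDiffAt (hI.mem_nhds ht)).mdifferentiableAt (by simp))
  refine ⟨fun h t ht hv => (key t ht hv).1 (h.2 t ht), fun h => ?_⟩
  -- The equations control only times with nonzero velocity; the constant-speed argument covers the
  -- others.
  exact hcovN.isGeodesicOn hβ hI hI' fun t ht hv => (key t ht hv).2 (h t ht hv)
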